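/- **Model.** A network $(G,G')$ consists of two undirected graphs on the same set $V$ of $n$ nodes with $E(G)\subseteq E(G')$; the classical model is the case $G=G'$. Processes (randomized automata) are assigned to the nodes bijectively and run in synchronous rounds $1,2,\dots$. In each round every process first gets its input, if any, from the environment, then decides whether to transmit; then an adversary who knows all states and transmissions chooses a reach set $R$ with $E(G)\subseteq R\subseteq E(G')$. A transmitting process hears only its own message. A silent process hears a message iff exactly one of its $R$-neighbours transmits, and otherwise hears nothing. Then the processes produce outputs. The environment, which may depend on the past, provides inputs $bcast(m)_v$, each with a new message $m$, the next one at $v$ only after the last one was acknowledged by an output $ack(m)_v$. A process is active with $m$ from the round of $bcast(m)_v$ to the round of $ack(m)_v$. Let $c(u,r,r')$ be the maximum over the rounds $t\in[r,r']$ of the number of $G'$-neighbours of $u$ that are active in round $t$, and $c'(v,r,r')=\max_{u\in N_G(v)}c(u,r,r')$. "W.h.p." means with probability at least $1-1/n$; for statements about what happens from round $r$ on, this is required conditionally on every possible history of the rounds before $r$. An algorithm *solves local broadcast* if in every execution (1) each $bcast(m)_v$ is eventually followed by exactly one $ack(m)_v$, and there are no other $ack$ outputs; (2) each $v$ outputs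 $rcv(m)_v$ at most once, and, if it does so in round $r$, some $G'$-neighbour of $v$ has got the input $bcast(m)$ before round $r$ and has not output $ack(m)$ before round $r$; (3) if $bcast(m)_v$ occurs in round $r$ and $ack(m)_v$ in round $r'\ge r$, then w.h.p. every $G$-neighbour of $v$ outputs $rcv(m)$ in a round of $[r,r']$. It has *acknowledgment bound* $f_{ack}$ if, for each $v$ and $r$, w.h.p.: if $bcast(m)_v$ occurs in round $r$ and $ack(m)_v$ in round $r'$, then $r'-r\le f_{ack}(c'(v,r,r'))$. It has *progress bound* $f_{prog}$ if, for all $u$ and $r\le r'$, w.h.p.: if $r'-r>f_{prog}(c(u,r,r'))$ and some $G$-neighbour of $u$ is active in every round of $[r,r']$, then $u$ outputs in some round $\le r'$ a $rcv(m)_u$ for a message $m$ that is active in some round of $[r,r']$. **Algorithm.** The processes are given $N$ with $n\le N\le n^{p}$ and $D$ with $\Delta\le D\le\kappa\Delta$, where $\Delta\ge2$ is a number that the contention (the number of active $G'$-neighbours of a node) never exceeds in any execution; for example, $\Delta$ is the maximum contention, if this is at least $2$. (In the dual graph model $\Delta$ is also written $\Delta'$.) Let $\lg x=\max(1,\lceil\log_2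 x\rceil)$. *SAP* divides its rounds into epochs. An epoch has phases $i=1,\dots,\lg D$; phase $i$ has $a2^i\lg N$ rounds. A process that got a message before the beginning of an epoch, and has not acknowledged it, transmits it in each round of phase $i$ of that epoch with probability $2^{-i}$, and acknowledges it at the end of the epoch. *SPP* (Decay) divides its rounds into epochs of $\lg D$ rounds; in the $i$-th round of an epoch a process that got its message before the beginning of the epoch transmits it with probability $2^{-i}$, and this is done in the first $bD\lg N$ epochs after the arrival of the message. *SAP interleaved with SPP* runs SAP in the odd and SPP in the even rounds; a process acknowledges its message when SAP does, and then both protocols stop working on it. A process outputs $rcv(m)$ when it first hears $m$ from another process. **Theorem.** For all sufficiently large integers $a$ and then all sufficiently large integers $b$ (depending only on $a$), and for all $\kappa$ and $p$, there is a constant $C>0$, depending only on $a,b,\kappa,p$, such that for all networks, bijections, environments and adversaries and all $N,D,\Delta$ as above, SAP interleaved with SPP solves local broadcast, and * in the dual graph model, it has the acknowledgment bound $f_{ack}(k)=C\,\Delta'\log n$ and the progress bound $f_{prog}(k)=C\min\{k\log\Delta'\log n,\ \Delta'\log n\}$, where $\Delta'=\Delta$; * in the classical model, where $G=G'$, it has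 the acknowledgment bound $f_{ack}(k)=C\,\Delta\log n$ and the progress bound $f_{prog}(k)=C\log\Delta\log n$. -/

import Mathlib

open scoped ENNReal

universe u v w

noncomputable section

namespace RadioNetwork

/-! ## Independent product of finitely many discrete distributions -/

theorem tsum_prod_fin : ∀ (n : ℕ) (α : Fin n → Type w) (p : ∀ i, PMF (α i)),
    ∑' f : (∀ i, α i), ∏ i, p i (f i) = 1
  | 0, α, p => by
      simp
  | n + 1, α, p => by
      rw [← (Fin.consEquiv α).tsum_eq (fun f => ∏ i, p i (f i)), ENNReal.tsum_prod']
      have h : ∀ (a : α 0) (g : ∀ i : Fin n, α i.succ),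
          ∏ i, p i ((Fin.consEquiv α) (a, g) i) = p 0 a * ∏ i : Fin n, p i.succ (g i) := by
        intro a g
        rw [Fin.prod_univ_succ]
        simp [Fin.consEquiv]
      simp_rw [h, ENNReal.tsum_mul_left]
      rw [tsum_prod_fin n (fun i => α i.succ) (fun i => p i.succ)]
      simp

theorem tsum_prod_pmf {ι : Type v} [Fintype ι] (α : ι → Type w) (p : ∀ i, PMF (α i)) :
    ∑' f : (∀ i, α i), ∏ i, p i (f i) = 1 := by
  have e := (Fintype.equivFin ι).symm
  rw [← (Equiv.piCongrLeft α e).tsum_eq (fun f => ∏ i, p i (f i)),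
    ← tsum_prod_fin (Fintype.card ι) (fun j => α (e j)) (fun j => p (e j))]
  refine tsum_congr fun f => ?_
  rw [← e.prod_comp]
  refine Finset.prod_congr rfl fun j _ => ?_
  rw [Equiv.piCongrLeft_apply_apply]

/-- The joint distribution of independent choices, choice `i` having distribution `p i`. -/
def independent {ι : Type v} [Fintype ι] {α : ι → Type w} (p : ∀ i, PMF (α i)) :
    PMF (∀ i, α i) :=
  ⟨fun f => ∏ i, p i (f i), by
    have h := ENNReal.summable.hasSum (f := fun f : (∀ i, α i) => ∏ i, p i (f i))
    rwa [tsum_prod_pmf] at h⟩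

/-- A coin that shows `true` with probability `1 / 2 ^ i`. -/
def coin (i : ℕ) : PMF Bool :=
  PMF.ofFintype (fun b => cond b ((2⁻¹ : ℝ≥0∞) ^ i) (1 - (2⁻¹ : ℝ≥0∞) ^ i)) (by
    rw [Fintype.sum_bool]
    exact add_tsub_cancel_of_le (pow_le_one' (by simp) i))

/-! ## The dual graph model -/

/-- A process with messages in `M`: a probabilistic automaton. In a round it first gets its input
from the environment (`some m` is the input `bcast(m)`) and decides at random on its transmission
(`send`); then it gets what it hears on the channel (`none` is silence), and produces its outputs
(`receive`): the new state, a possible output `rcv(m)`, a possible output `ack(m)`. -/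
structure Automaton (M : Type u) where
  State : Type u
  init : State
  send : State → Option M → PMF (State × Option M)
  receive : State → Option M → State × Option M × Option M

/-- Everything that happens in one round of an execution in which node `x` runs process `P x`.
`state` is the state at the end of the round. -/
structure Round {M : Type u} {V : Type v} (P : V → Automaton M) where
  bcast : V → Option M
  sent : V → Option M
  reach : SimpleGraph V
  heard : V → Option M
  rcv : V → Option M
  ack : V → Option M
  state : ∀ x, (P x).State

/-- What node `x` hears, if `sent` are the transmissions and `R` is the reach set. -/
def hears {M : Type u} {V : Type v} (R : SimpleGraph V) (sent : V → Option M) (x : V) :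
    Option M :=
  open Classical in
  if (sent x).isSome then sent x
  else if h : ∃! y, R.Adj x y ∧ (sent y).isSome then sent h.choose
  else none

/-- A distributed algorithm for the nodes `V`: one process for each identifier. -/
abbrev Algorithm (V : Type v) [Fintype V] (M : Type u) := Fin (Fintype.card V) → Automaton M

/-- Everything that is not under the control of the algorithm `A`: the network `(G, G')`, the
assignment of processes to nodes, the environment, which chooses the inputs of each round
knowing all that happened before, and the adversary, which chooses the reach set of each round
knowing all that happened before and, for the present round, the inputs, the states
and the transmissions. A list of rounds is always in chronological order. -/
structure Setting {V : Type v} [Fintype V] {M : Type u} (A : Algorithm V M) where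
  G : SimpleGraph V
  G' : SimpleGraph V
  le : G ≤ G'
  proc : V ≃ Fin (Fintype.card V)
  env : List (Round fun x => A (proc x)) → V → Option M
  adv : List (Round fun x => A (proc x)) → (V → Option M) → (∀ x, (A (proc x)).State) →
    (V → Option M) → SimpleGraph V
  le_adv : ∀ h i s t, G ≤ adv h i s t
  adv_le : ∀ h i s t, adv h i s t ≤ G'

namespace Setting

variable {V : Type v} [Fintype V] {M : Type u} {A : Algorithm V M} (X : Setting A)

/-- The process at each node. -/
abbrev P (x : V) : Automaton M := A (X.proc x)

/-- Finite executions. The entry with index `t` (from `0`) is the round number `t + 1`. -/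
abbrev History := List (Round X.P)

/-- The state of the process at node `x` after the history `h`. -/
def stateAfter (h : X.History) (x : V) : (X.P x).State :=
  match h.getLast? with
  | none => (X.P x).init
  | some ρ => ρ.state x

/-- The round that follows `h`, once the random choices `c` of the processes are made. -/
def nextRound (h : X.History) (c : ∀ x, (X.P x).State × Option M) : Round X.P :=
  let sent : V → Option M := fun x => (c x).2
  let reach := X.adv h (X.env h) (fun x => (c x).1) sent
  let out := fun x => (X.P x).receive (c x).1 (hears reach sent x)
  { bcast := X.env h
    sent := sent
    reach := reach
    heard := hears reach sent
    rcv := fun x => (out x).2.1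
    ack := fun x => (out x).2.2
    state := fun x => (out x).1 }

/-- The distribution of the round that follows `h`: the processes choose independently. -/
def roundDist (h : X.History) : PMF (Round X.P) :=
  (independent fun x => (X.P x).send (X.stateAfter h x) (X.env h x)).map (X.nextRound h)

/-- The distribution of the history that extends `h` by `k` further rounds. -/
def runFrom (h : X.History) : ℕ → PMF X.History
  | 0 => PMF.pure h
  | k + 1 => (runFrom h k).bind fun h' => (X.roundDist h').map fun ρ => h' ++ [ρ]

/-- `h` is a possible beginning of an execution. -/
def Reachable (h : X.History) : Prop := h ∈ (X.runFrom [] h.length).support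

/-- `e` is an (infinite) execution. -/
def IsExecution (e : ℕ → Round X.P) : Prop :=
  ∀ T : ℕ, X.Reachable ((List.range T).map e)

/-! ### Events in a history, in terms of the round index `t` -/

/-- Input `bcast(m)` at node `x` in round `t`. -/
def BcastAt (h : X.History) (t : ℕ) (x : V) (m : M) : Prop :=
  ∃ ρ, h[t]? = some ρ ∧ ρ.bcast x = some m

/-- Output `rcv(m)` at node `x` in round `t`. -/
def RcvAt (h : X.History) (t : ℕ) (x : V) (m : M) : Prop :=
  ∃ ρ, h[t]? = some ρ ∧ ρ.rcv x = some m

/-- Output `ack(m)` at node `x` in round `t`. -/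
def AckAt (h : X.History) (t : ℕ) (x : V) (m : M) : Prop :=
  ∃ ρ, h[t]? = some ρ ∧ ρ.ack x = some m

/-- Node `x` is active with `m` in round `t`: it got the input `bcast(m)` in a round `≤ t` and has
not output `ack(m)` before round `t` (outputs come at the end of a round). -/
def ActiveWith (h : X.History) (t : ℕ) (x : V) (m : M) : Prop :=
  (∃ s ≤ t, X.BcastAt h s x m) ∧ ∀ s < t, ¬ X.AckAt h s x m

/-- Node `x` is active in round `t`. -/
def Active (h : X.History) (t : ℕ) (x : V) : Prop := ∃ m, X.ActiveWith h t x m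

/-- The contention `c(x, t)`: the number of active `G'`-neighbours of `x` in round `t`. -/
def contention (h : X.History) (x : V) (t : ℕ) : ℕ :=
  open Classical in (Finset.univ.filter fun y => X.G'.Adj x y ∧ X.Active h t y).card

/-- `c(x, r, r')`, the maximum of `c(x, t)` over the rounds `t ∈ [r, r']`. -/
def contentionOn (h : X.History) (x : V) (r r' : ℕ) : ℕ :=
  (Finset.Icc r r').sup (X.contention h x)

/-- `c'(x, r, r')`, the maximum of `c(y, r, r')` over the `G`-neighbours `y` of `x`. -/
def nbrContentionOn (h : X.History) (x : V) (r r' : ℕ) : ℕ :=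
  open Classical in
  (Finset.univ.filter fun y => X.G.Adj x y).sup fun y => X.contentionOn h y r r'

/-- The maximum contention, over all nodes, rounds and executions. -/
def maxContention : ℕ∞ :=
  ⨆ (h : X.History) (_ : X.Reachable h) (x : V) (t : ℕ) (_ : t < h.length),
    (X.contention h x t : ℕ∞)

/-- The environment is well-formed: no message is input twice, and after an input at a node it
makes the next input there only when an `ack` output has occurred there in between. -/
def WellFormed : Prop :=
  ∀ h : X.History, X.Reachable h →
    (∀ s t x y m, X.BcastAt h s x m → X.BcastAt h t y m → s = t ∧ x = y) ∧
    (∀ s t x m m', s < t → X.BcastAt h s x m → X.BcastAt h t x m' →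
      ∃ q m'', s ≤ q ∧ q < t ∧ X.AckAt h q x m'')

/-- For an event `E` about the rounds from `r` on: whatever happens in the rounds before `r`,
`E` holds with (conditional) probability at least `1 - 1 / n` in the history of the first
`r + k` rounds, where `n` is the number of nodes. -/
def WHP (r k : ℕ) (E : X.History → Prop) : Prop :=
  ∀ h₀ : X.History, X.Reachable h₀ → h₀.length = r →
    1 - 1 / (Fintype.card V : ℝ≥0∞) ≤ (X.runFrom h₀ k).toOuterMeasure {h | E h}

/-- The algorithm solves the local broadcast problem in the setting `X`. -/
structure SolvesLocalBroadcast : Prop where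
  /-- Each `bcast(m)` input is answered eventually by a single `ack(m)` output. -/
  ack_of_bcast : ∀ e, X.IsExecution e → ∀ t x m, (e t).bcast x = some m →
    ∃ t' ≥ t, (e t').ack x = some m ∧ ∀ s, (e s).ack x = some m → s = t'
  /-- There are no other `ack` outputs. -/
  bcast_of_ack : ∀ e, X.IsExecution e → ∀ t' x m, (e t').ack x = some m →
    ∃ t ≤ t', (e t).bcast x = some m
  /-- A node outputs `rcv(m)` at most once. -/
  rcv_unique : ∀ e, X.IsExecution e → ∀ s t x m,
    (e s).rcv x = some m → (e t).rcv x = some m → s = t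
  /-- A node outputs `rcv(m)` only if `m` comes from a `G'`-neighbour that has got the input
  `bcast(m)` and not yet acknowledged it. -/
  rcv_valid : ∀ e, X.IsExecution e → ∀ t x m, (e t).rcv x = some m →
    ∃ y, X.G'.Adj x y ∧ (∃ s < t, (e s).bcast y = some m) ∧ ∀ s < t, (e s).ack y ≠ some m
  /-- With high probability an acknowledged message has been delivered to all `G`-neighbours. -/
  reliable : ∀ x r k, X.WHP r k fun h => ∀ m r', r ≤ r' → X.BcastAt h r x m → X.AckAt h r' x m →
    ∀ y, X.G.Adj x y → ∃ t, r ≤ t ∧ t ≤ r' ∧ X.RcvAt h t y m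

/-- `f` is an acknowledgment bound (as a function of the contention). -/
def HasAckBound (f : ℕ → ℝ) : Prop :=
  ∀ x r k, X.WHP r k fun h => ∀ m r', r ≤ r' → X.BcastAt h r x m → X.AckAt h r' x m →
    (r' : ℝ) - r ≤ f (X.nbrContentionOn h x r r')

/-- `f` is a progress bound (as a function of the contention): for rounds `r ≤ r' = r + d`, in the
history up to the end of round `r'`. -/
def HasProgressBound (f : ℕ → ℝ) : Prop :=
  ∀ x r d, X.WHP r (d + 1) fun h =>
    f (X.contentionOn h x r (r + d)) < (d : ℝ) →
    (∃ y, X.G.Adj x y ∧ ∀ t, r ≤ t → t ≤ r + d → X.Active h t y) →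
    ∃ m, (∃ s ≤ r + d, X.RcvAt h s x m) ∧
      ∃ t y, r ≤ t ∧ t ≤ r + d ∧ X.ActiveWith h t y m

end Setting

/-! ## The protocols SAP and SPP, and their interleaving -/

/-- The binary logarithm, rounded up to a positive integer. -/
def lg (k : ℕ) : ℕ := max 1 (Nat.clog 2 k)

/-- The sending rule of a protocol whose rounds are `0, 1, 2, …`. Consider a message that is input
to a process in time for round `s` and not earlier, i.e. `s` is the first round that begins
after the input. If `level s j = some i`, the process sends it in round `j` with
probability `1 / 2 ^ i`; if `level s j = none`, the process is silent. If `acks s j`,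
it acknowledges the message at the end of round `j`. -/
structure Protocol where
  level : ℕ → ℕ → Option ℕ
  acks : ℕ → ℕ → Prop

/-- The levels of the rounds of one epoch of SAP: for `i = 1, …, lg D`, there are
`a * 2 ^ i * lg N` rounds with level `i`. -/
def sapEpoch (a N D : ℕ) : List ℕ :=
  (List.range (lg D)).flatMap fun i => List.replicate (a * 2 ^ (i + 1) * lg N) (i + 1)

/-- The levels of the rounds of one epoch of SPP (Decay): `1, …, lg D`. -/
def sppEpoch (D : ℕ) : List ℕ := (List.range (lg D)).map (· + 1)

/-- Synchronous Acknowledgment Protocol: the rounds are divided into epochs. A message that is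
input before the beginning of an epoch is sent in this epoch, and acknowledged at its end. -/
def SAP (a N D : ℕ) : Protocol where
  level s j :=
    let len := (sapEpoch a N D).length
    if s ≤ len * (j / len) then some ((sapEpoch a N D).getD (j % len) 0) else none
  acks s j :=
    let len := (sapEpoch a N D).length
    s ≤ len * (j / len) ∧ len ∣ j + 1

/-- Synchronous Progress Protocol: the rounds are divided into epochs. A message is sent in the
first `b * D * lg N` epochs that begin after its input, and then acknowledged. -/
def SPP (b N D : ℕ) : Protocol where
  level s j :=
    let len := (sppEpoch D).length
    if s ≤ len * (j / len) ∧ len * (j / len) < s + len * (b * D * lg N)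
    then some ((sppEpoch D).getD (j % len) 0) else none
  acks s j :=
    let len := (sppEpoch D).length
    s ≤ len * (j / len) ∧ len * (j / len) < s + len * (b * D * lg N) ∧
      s + len * (b * D * lg N) ≤ len * (j / len + 1) ∧ len ∣ j + 1

/-- The state of a process that runs an interleaving: the number of completed rounds, the message
being broadcast with the index of the round of its input, and the messages received. -/
structure InterleaveState (M : Type u) where
  clock : ℕ
  pending : Option (M × ℕ)
  received : Set M

/-- The level at which the interleaving of `P` and `Q` sends in the round with index `t` a message
that was input at the beginning of the round with index `t₀`. Round number `t + 1` is odd iff `t`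
is even; the odd round `2 j + 1` is round `j` of `P`, the even round `2 j + 2` is round `j` of
`Q`. -/
def interleaveLevel (P Q : Protocol) (t₀ t : ℕ) : Option ℕ :=
  if Even t then P.level (t₀ / 2 + 1) (t / 2) else Q.level ((t₀ + 1) / 2) (t / 2)

/-- A process that runs `P` in odd and `Q` in even rounds on each message, until `P` acknowledges
the message; then the process acknowledges it and both protocols are finished with it. It passes
each message that it hears from another process to the environment, once. -/
def interleave (P Q : Protocol) (M : Type u) : Automaton M where
  State := InterleaveState M
  init := ⟨0, none, ∅⟩
  send σ input :=
    let pending := match input with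
      | some m => some (m, σ.clock)
      | none => σ.pending
    let σ' : InterleaveState M := { σ with pending := pending }
    match pending with
    | none => PMF.pure (σ', none)
    | some (m, t₀) =>
      match interleaveLevel P Q t₀ σ.clock with
      | none => PMF.pure (σ', none)
      | some i => (coin i).map fun b => (σ', if b then some m else none)
  receive σ heard :=
    open Classical in
    let new : Option M := heard.filter fun m =>
      m ∉ σ.received ∧ ∀ q ∈ σ.pending, q.1 ≠ m
    let done : Option M := (σ.pending.filter fun q =>
      Even σ.clock ∧ P.acks (q.2 / 2 + 1) (σ.clock / 2)).map Prod.fst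
    ({ clock := σ.clock + 1
       pending := if done.isSome then none else σ.pending
       received := σ.received ∪ {m | new = some m} }, new, done)

/-- SAP in odd rounds interleaved with SPP in even rounds. `N` and `D` are the bounds on the
network size and on the contention with which the processes are provided; `a` and `b` are the
constant factors in the lengths of SAP's phases and in the duration of SPP. -/
def sapSpp (a b N D : ℕ) (V : Type v) [Fintype V] (M : Type u) : Algorithm V M :=
  fun _ => interleave (SAP a N D) (SPP b N D) M

end RadioNetwork

end

noncomputable section

namespace RadioNetwork

/-! ## Discrete probability -/

/-! One round. All processes that may send in a given round do so with the same probability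
`2^{-i}`. Suppose that at most `2^i` of the `G'`-neighbours of `x` take part. With probability at
least `2^{-i} (1 - 2^{-i})^{2^i} ≥ 2^{-i} / 4`, a given participating `G`-neighbour `y` sends while
`x` and all its other `G'`-neighbours are silent; then `x` hears `y` whatever reach set the
adversary picks. For different `y` these events are disjoint, so the bounds add up (`le_prob_hit`).

Many rounds. These bounds depend on the past, since the environment and the adversary are adaptive.
But the exponential of their running sum, replaced by `0` after the first hit, is a supermartingale.
So a miss in spite of bounds with sum at least `Q` has probability at most `e^{-Q}`, conditionally
on any earlier history (`miss_le_exp`). It remains to show, for each possible history, that the sum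
is large.

SAP. The participants of an epoch are fixed when it begins, and `x` then has some contention `k`.
Phase `lg k` has `a 2^{lg k} lg N` rounds with bound at least `2^{-lg k} / 4` each, in total `a lg N
/ 4` (`le_sum_hitRate_sap`). For `a ≥ 8` this is at least `2 log n`, enough for a union bound over
the neighbours of the sender. The acknowledgment bound holds surely: two epochs have `O(Δ log n)`
rounds.

SPP. Each epoch has one round at level `lg k`. A single target gives `1 / (8 k)`; if `G = G'`, all
`k` active neighbours are targets and give `1 / 8` (`exists_le_hitRate_spp`). So `O(k log n)`,
respectively `O(log n)`, epochs of `lg D` rounds suffice, provided that nobody stops inside an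
epoch. All acknowledgments fall on the ends of SAP epochs, so a short interval has a long part
without any (`exists_quiet_interval`); a long interval contains a whole SAP epoch, which suffices
alone. The condition `b > 8 a` keeps SPP running until SAP acknowledges. -/

theorem tsum_prod_fin_eq : ∀ (n : ℕ) (α : Fin n → Type w) (g : ∀ i, α i → ℝ≥0∞),
    ∑' f : (∀ i, α i), ∏ i, g i (f i) = ∏ i, ∑' a, g i a
  | 0, α, g => by simp
  | n + 1, α, g => by
      rw [← (Fin.consEquiv α).tsum_eq (fun f => ∏ i, g i (f i)), ENNReal.tsum_prod']
      have h : ∀ (a : α 0) (f : ∀ i : Fin n, α i.succ),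
          ∏ i, g i ((Fin.consEquiv α) (a, f) i) = g 0 a * ∏ i : Fin n, g i.succ (f i) := by
        intro a f
        rw [Fin.prod_univ_succ]
        simp [Fin.consEquiv]
      simp_rw [h, ENNReal.tsum_mul_left]
      rw [tsum_prod_fin_eq n (fun i => α i.succ) (fun i => g i.succ), ENNReal.tsum_mul_right,
        Fin.prod_univ_succ]

theorem tsum_prod_eq {ι : Type v} [Fintype ι] (α : ι → Type w) (g : ∀ i, α i → ℝ≥0∞) :
    ∑' f : (∀ i, α i), ∏ i, g i (f i) = ∏ i, ∑' a, g i a := by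
  have e := (Fintype.equivFin ι).symm
  rw [← (Equiv.piCongrLeft α e).tsum_eq (fun f => ∏ i, g i (f i)), ← e.prod_comp,
    ← tsum_prod_fin_eq (Fintype.card ι) (fun j => α (e j)) (fun j => g (e j))]
  refine tsum_congr fun f => ?_
  rw [← e.prod_comp]
  refine Finset.prod_congr rfl fun j _ => ?_
  rw [Equiv.piCongrLeft_apply_apply]

/-- The indicator of a box is a product, so the sum over the box factors. -/
theorem toOuterMeasure_independent_pi {ι : Type v} [Fintype ι] {α : ι → Type w}
    (p : ∀ i, PMF (α i)) (S : ∀ i, Set (α i)) :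
    (independent p).toOuterMeasure {f | ∀ i, f i ∈ S i} = ∏ i, (p i).toOuterMeasure (S i) := by
  classical
  simp_rw [PMF.toOuterMeasure_apply]
  rw [← tsum_prod_eq]
  refine tsum_congr fun f => ?_
  by_cases hf : ∀ i, f i ∈ S i
  · rw [Set.indicator_of_mem (by exact hf)]
    exact Finset.prod_congr rfl fun i _ => (Set.indicator_of_mem (hf i) _).symm
  · rw [Set.indicator_of_notMem (by exact hf)]
    push Not at hf
    obtain ⟨i, hi⟩ := hf
    exact (Finset.prod_eq_zero (Finset.mem_univ i) (Set.indicator_of_notMem hi _)).symm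

theorem apply_mem_support_of_independent {ι : Type v} [Fintype ι] {α : ι → Type w}
    (p : ∀ i, PMF (α i)) {f : ∀ i, α i} (hf : f ∈ (independent p).support) (i : ι) :
    f i ∈ (p i).support := by
  rw [PMF.mem_support_iff] at hf ⊢
  exact Finset.prod_ne_zero_iff.1 (show ∏ i, p i (f i) ≠ 0 from hf) i (Finset.mem_univ i)

theorem toOuterMeasure_add_compl {α : Type w} (p : PMF α) (S : Set α) :
    p.toOuterMeasure S + p.toOuterMeasure Sᶜ = 1 := by
  rw [PMF.toOuterMeasure_apply, PMF.toOuterMeasure_apply, ← ENNReal.tsum_add, ← p.tsum_coe]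
  exact tsum_congr fun a => Set.indicator_self_add_compl_apply S p a

theorem toOuterMeasure_eq_tsum {α : Type w} (p : PMF α) (S : Set α) :
    p.toOuterMeasure S = ∑' a, p a * S.indicator 1 a := by
  rw [PMF.toOuterMeasure_apply]
  refine tsum_congr fun a => ?_
  by_cases h : a ∈ S <;> simp [h]

theorem tsum_bind_mul {α β : Type w} (p : PMF α) (f : α → PMF β) (W : β → ℝ≥0∞) :
    ∑' b, p.bind f b * W b = ∑' a, p a * ∑' b, f a b * W b := by
  simp_rw [PMF.bind_apply, ← ENNReal.tsum_mul_right, ← ENNReal.tsum_mul_left]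
  rw [ENNReal.tsum_comm]
  simp_rw [mul_assoc]

theorem tsum_pure_mul {α : Type w} (a : α) (W : α → ℝ≥0∞) :
    ∑' b, PMF.pure a b * W b = W a := by
  rw [tsum_eq_single a]
  · simp
  · intro b hb
    simp [PMF.pure_apply, hb]

theorem tsum_map_mul {α β : Type w} (p : PMF α) (f : α → β) (W : β → ℝ≥0∞) :
    ∑' b, p.map f b * W b = ∑' a, p a * W (f a) := by
  rw [← PMF.bind_pure_comp, tsum_bind_mul]
  exact tsum_congr fun a => by simp only [Function.comp_apply, tsum_pure_mul]

namespace Setting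

variable {V : Type v} [Fintype V] {M : Type u} {A : Algorithm V M} (X : Setting A)

/-! ## Possible histories -/

theorem reachable_nil : X.Reachable [] := by
  simp [Reachable, runFrom]

theorem reachable_append_singleton {h : X.History} {ρ : Round X.P} :
    X.Reachable (h ++ [ρ]) ↔ X.Reachable h ∧ ρ ∈ (X.roundDist h).support := by
  simp only [Reachable, List.length_append, List.length_singleton, runFrom,
    PMF.mem_support_bind_iff, PMF.mem_support_map_iff]
  constructor
  · rintro ⟨h', hh', ρ', hρ', heq⟩
    obtain ⟨rfl, hr⟩ := List.append_inj' heq rfl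
    obtain rfl : ρ' = ρ := by simpa using hr
    exact ⟨hh', hρ'⟩
  · rintro ⟨hh, hρ⟩
    exact ⟨h, hh, ρ, hρ, rfl⟩

theorem Reachable.induction {X : Setting A} {C : X.History → Prop} (nil : C [])
    (step : ∀ h ρ, X.Reachable h → ρ ∈ (X.roundDist h).support → C h → C (h ++ [ρ]))
    {h : X.History} (hh : X.Reachable h) : C h := by
  induction h using List.reverseRecOn with
  | nil => exact nil
  | append_singleton h ρ ih =>
    obtain ⟨h1, h2⟩ := X.reachable_append_singleton.1 hh
    exact step h ρ h1 h2 (ih h1)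

theorem Reachable.take {X : Setting A} {h : X.History} (hh : X.Reachable h) (t : ℕ) :
    X.Reachable (h.take t) := by
  refine Reachable.induction (C := fun h => X.Reachable (h.take t)) ?_ ?_ hh
  · simpa using X.reachable_nil
  · intro h ρ h1 h2 ih
    by_cases ht : t ≤ h.length
    · rwa [List.take_append_of_le_length ht]
    · rw [List.take_of_length_le (by simp; omega)]
      exact X.reachable_append_singleton.2 ⟨h1, h2⟩

theorem Reachable.take_succ {X : Setting A} {h : X.History} (hh : X.Reachable h) {t : ℕ}
    {ρ : Round X.P} (ht : h[t]? = some ρ) : h.take (t + 1) = h.take t ++ [ρ] ∧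
      ρ ∈ (X.roundDist (h.take t)).support := by
  have h1 : h.take (t + 1) = h.take t ++ [ρ] := by
    rw [List.take_add_one, ht]; rfl
  have h2 := hh.take (t + 1)
  rw [h1] at h2
  exact ⟨h1, (X.reachable_append_singleton.1 h2).2⟩

theorem reachable_of_mem_runFrom {h₀ : X.History} (hh₀ : X.Reachable h₀) :
    ∀ (k : ℕ) {h : X.History}, h ∈ (X.runFrom h₀ k).support →
      X.Reachable h ∧ h.length = h₀.length + k
  | 0, h, hh => by
    obtain rfl : h = h₀ := by simpa [runFrom] using hh
    exact ⟨hh₀, rfl⟩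
  | k + 1, h, hh => by
    simp only [runFrom, PMF.mem_support_bind_iff, PMF.mem_support_map_iff] at hh
    obtain ⟨h', hh', ρ, hρ, rfl⟩ := hh
    obtain ⟨h1, h2⟩ := reachable_of_mem_runFrom hh₀ k hh'
    exact ⟨X.reachable_append_singleton.2 ⟨h1, hρ⟩, by simp [h2]; omega⟩

/-! ## A supermartingale bound -/

/-- Expectations of a supermartingale do not increase. The hypothesis is needed only at reachable
histories because the others have weight zero. -/
theorem tsum_runFrom_mul_le (W : X.History → ℝ≥0∞)
    (hW : ∀ h, X.Reachable h → ∑' ρ, X.roundDist h ρ * W (h ++ [ρ]) ≤ W h)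
    {h₀ : X.History} (hh₀ : X.Reachable h₀) (k : ℕ) :
    ∑' h, X.runFrom h₀ k h * W h ≤ W h₀ := by
  induction k with
  | zero => simp only [runFrom]; rw [tsum_pure_mul]
  | succ k ih =>
    simp only [runFrom]
    rw [tsum_bind_mul]
    refine le_trans (ENNReal.tsum_le_tsum fun h => ?_) ih
    rw [tsum_map_mul]
    by_cases hh : h ∈ (X.runFrom h₀ k).support
    · exact mul_le_mul_right (hW h (X.reachable_of_mem_runFrom hh₀ k hh).1) _
    · rw [(PMF.apply_eq_zero_iff _ _).2 hh]; simp

/-- This is `1 - q ≤ exp (-q)`, arranged without subtraction in `ℝ≥0∞`. -/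
theorem compl_le_exp {α : Type w} (p : PMF α) (S : Set α) (q : ℝ)
    (h : ENNReal.ofReal q ≤ p.toOuterMeasure S) :
    p.toOuterMeasure Sᶜ ≤ ENNReal.ofReal (Real.exp (-q)) := by
  have h1 := toOuterMeasure_add_compl p S
  have hS : p.toOuterMeasure S ≠ ∞ := fun h2 => by simp [h2] at h1
  rw [← ENNReal.add_le_add_iff_left hS, h1]
  calc (1 : ℝ≥0∞) = ENNReal.ofReal 1 := by simp
    _ ≤ ENNReal.ofReal (q + Real.exp (-q)) :=
        ENNReal.ofReal_le_ofReal (by linarith [Real.add_one_le_exp (-q)])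
    _ ≤ ENNReal.ofReal q + ENNReal.ofReal (Real.exp (-q)) := ENNReal.ofReal_add_le
    _ ≤ _ := by gcongr

/-- If, given the past `h`, the event `H` occurs in the next round with probability at least
`q h`, then it is unlikely that `H` does not occur in the rounds of `I` although the sum
of these probabilities is large. -/
theorem miss_le_exp (H : Round X.P → Prop) (q : X.History → ℝ)
    (hq : ∀ h, X.Reachable h → ENNReal.ofReal (q h) ≤ (X.roundDist h).toOuterMeasure {ρ | H ρ})
    (I : Finset ℕ) {h₀ : X.History} (hh₀ : X.Reachable h₀) (hI : ∀ t ∈ I, h₀.length ≤ t)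
    (k : ℕ) (Q : ℝ) :
    (X.runFrom h₀ k).toOuterMeasure {h | (∀ t ∈ I, t < h.length) ∧
        (∀ t ∈ I, ∀ ρ, h[t]? = some ρ → ¬ H ρ) ∧ Q ≤ ∑ t ∈ I, q (h.take t)} ≤
      ENNReal.ofReal (Real.exp (-Q)) := by
  classical
  let s : X.History → ℝ := fun h => ∑ t ∈ I with t < h.length, q (h.take t)
  -- The supermartingale: it gains the factor `exp (q h)` in each round of `I` and dies at the first
  -- hit.
  let W : X.History → ℝ≥0∞ := fun h =>
    if ∀ t ∈ I, ∀ ρ, h[t]? = some ρ → ¬ H ρ then ENNReal.ofReal (Real.exp (s h)) else 0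
  have hW : ∀ h, X.Reachable h → ∑' ρ, X.roundDist h ρ * W (h ++ [ρ]) ≤ W h := by
    intro h hh
    by_cases hc : ∀ t ∈ I, ∀ ρ, h[t]? = some ρ → ¬ H ρ
    · have hWh : W h = ENNReal.ofReal (Real.exp (s h)) := if_pos hc
      have htake : ∀ ρ, ∑ t ∈ I with t < h.length, q ((h ++ [ρ]).take t) = s h := fun ρ =>
        Finset.sum_congr rfl fun t ht => by
          rw [List.take_append_of_le_length (Finset.mem_filter.1 ht).2.le]
      by_cases hlen : h.length ∈ I
      · have hs : ∀ ρ, s (h ++ [ρ]) = q h + s h := by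
          intro ρ
          have : (I.filter fun t => t < (h ++ [ρ]).length) =
              insert h.length (I.filter fun t => t < h.length) := by
            ext t
            simp only [Finset.mem_filter, Finset.mem_insert, List.length_append,
              List.length_singleton]
            constructor
            · rintro ⟨h1, h2⟩
              by_cases h3 : t = h.length
              · exact Or.inl h3
              · exact Or.inr ⟨h1, by omega⟩
            · rintro (rfl | h1)
              · exact ⟨hlen, by omega⟩
              · exact ⟨h1.1, by omega⟩
          simp only [s]
          rw [this, Finset.sum_insert (by simp)]
          congr 1
          · simp
          · exact htake ρ
        have hle : ∀ ρ, X.roundDist h ρ * W (h ++ [ρ]) ≤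
            (X.roundDist h ρ * Set.indicator {ρ | H ρ}ᶜ 1 ρ) *
              ENNReal.ofReal (Real.exp (q h + s h)) := by
          intro ρ
          rw [mul_assoc]
          refine mul_le_mul_right ?_ _
          by_cases hρ : H ρ
          · have : ¬ ∀ t ∈ I, ∀ ρ', (h ++ [ρ])[t]? = some ρ' → ¬ H ρ' := fun h1 =>
              h1 _ hlen ρ (by simp) hρ
            simp only [W, if_neg this]
            exact zero_le
          · rw [Set.indicator_of_mem (by exact hρ)]
            simp only [W, hs]
            split_ifs <;> simp
        refine (ENNReal.tsum_le_tsum hle).trans ?_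
        rw [ENNReal.tsum_mul_right, ← toOuterMeasure_eq_tsum, hWh]
        -- The survival probability is at most `exp (-q h)`, which cancels the gain.
        refine (mul_le_mul_left (compl_le_exp _ _ _ (hq h hh)) _).trans ?_
        rw [← ENNReal.ofReal_mul (Real.exp_pos _).le, ← Real.exp_add]
        simp
      · have hs : ∀ ρ, s (h ++ [ρ]) = s h := by
          intro ρ
          have : (I.filter fun t => t < (h ++ [ρ]).length) = I.filter fun t => t < h.length := by
            ext t
            simp only [Finset.mem_filter, List.length_append, List.length_singleton]
            refine and_congr_right fun h1 => ?_
            have : t ≠ h.length := fun h2 => hlen (h2 ▸ h1)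
            omega
          simp only [s]
          rw [this]
          exact htake ρ
        have hle : ∀ ρ, W (h ++ [ρ]) ≤ W h := by
          intro ρ
          rw [hWh]
          simp only [W, hs]
          split_ifs <;> simp
        refine (ENNReal.tsum_le_tsum fun ρ => mul_le_mul_right (hle ρ) _).trans ?_
        rw [ENNReal.tsum_mul_right, PMF.tsum_coe, one_mul]
    · have h0 : ∀ ρ, W (h ++ [ρ]) = 0 := by
        intro ρ
        refine if_neg fun h1 => hc fun t ht ρ' hρ' => h1 t ht ρ' ?_
        rw [List.getElem?_append_left, hρ']
        exact (List.getElem?_eq_some_iff.1 hρ').1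
      simp [h0]
  have hW₀ : W h₀ = 1 := by
    have h1 : (I.filter fun t => t < h₀.length) = ∅ :=
      Finset.filter_eq_empty_iff.2 fun t ht => by have := hI t ht; omega
    have h2 : ∀ t ∈ I, ∀ ρ, h₀[t]? = some ρ → ¬ H ρ := by
      intro t ht ρ hρ
      have := (List.getElem?_eq_some_iff.1 hρ).1
      have := hI t ht
      omega
    simp only [W, s]
    rw [if_pos h2, h1]
    simp
  -- Markov's inequality: on the event, `W h` is at least `exp Q`.
  calc _ ≤ ∑' h, X.runFrom h₀ k h * (W h * ENNReal.ofReal (Real.exp (-Q))) := by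
        rw [toOuterMeasure_eq_tsum]
        refine ENNReal.tsum_le_tsum fun h => mul_le_mul_right ?_ _
        rw [Set.indicator_apply]
        split_ifs with hh
        swap
        · exact zero_le
        obtain ⟨h1, h2, h3⟩ := hh
        have h4 : (I.filter fun t => t < h.length) = I := Finset.filter_true_of_mem h1
        simp only [W, s]
        rw [if_pos h2, h4, ← ENNReal.ofReal_mul (Real.exp_pos _).le, ← Real.exp_add]
        simpa using h3
    _ = (∑' h, X.runFrom h₀ k h * W h) * ENNReal.ofReal (Real.exp (-Q)) := by
        rw [← ENNReal.tsum_mul_right]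
        exact tsum_congr fun h => (mul_assoc _ _ _).symm
    _ ≤ 1 * ENNReal.ofReal (Real.exp (-Q)) := by
        refine mul_le_mul_left ?_ _
        rw [← hW₀]
        exact X.tsum_runFrom_mul_le W hW hh₀ k
    _ = _ := one_mul _

/-- An event holds with high probability if its complement is covered by the events `F y`. -/
theorem whp_of_cover {r k : ℕ} {E : X.History → Prop} (F : V → X.History → Prop) (S : Finset V)
    (hF : ∀ h₀, X.Reachable h₀ → h₀.length = r → ∑ y ∈ S,
      (X.runFrom h₀ k).toOuterMeasure {h | F y h} ≤ 1 / (Fintype.card V : ℝ≥0∞))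
    (hE : ∀ h, X.Reachable h → h.length = r + k → ¬ E h → ∃ y ∈ S, F y h) :
    X.WHP r k E := by
  intro h₀ hh₀ hr
  rw [tsub_le_iff_right]
  refine (toOuterMeasure_add_compl (X.runFrom h₀ k) {h | E h}).symm.le.trans ?_
  gcongr
  refine le_trans ?_ (hF h₀ hh₀ hr)
  calc _ ≤ (X.runFrom h₀ k).toOuterMeasure (⋃ y ∈ S, {h | F y h}) := by
        refine PMF.toOuterMeasure_mono _ ?_
        rintro h ⟨h1, h2⟩
        obtain ⟨h3, h4⟩ := X.reachable_of_mem_runFrom hh₀ k h2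
        obtain ⟨y, hy, hy'⟩ := hE h h3 (by omega) h1
        exact Set.mem_biUnion (show y ∈ (S : Set V) from hy) hy'
    _ ≤ _ := MeasureTheory.measure_biUnion_finset_le _ _

end Setting

/-! ### Reception on the channel; events in extended and truncated histories -/

theorem hears_of_isSome {M : Type u} {V : Type v} {R : SimpleGraph V} {sent : V → Option M} {x : V}
    (hx : (sent x).isSome) : hears R sent x = sent x := by
  rw [hears, if_pos hx]

theorem exists_adj_of_hears {M : Type u} {V : Type v} {R : SimpleGraph V} {sent : V → Option M}
    {x : V} {m : M} (hx : sent x = none) (h : hears R sent x = some m) :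
    ∃ y, R.Adj x y ∧ sent y = some m := by
  rw [hears, if_neg (by simp [hx])] at h
  split_ifs at h with h1
  exact ⟨_, h1.choose_spec.1.1, h⟩

theorem hears_eq_of_unique {M : Type u} {V : Type v} {R : SimpleGraph V} {sent : V → Option M}
    {x y : V} (hx : sent x = none) (hxy : R.Adj x y) (hy : (sent y).isSome)
    (hu : ∀ z, R.Adj x z → z ≠ y → sent z = none) : hears R sent x = sent y := by
  have h1 : ∃! y, R.Adj x y ∧ (sent y).isSome := by
    refine ⟨y, ⟨hxy, hy⟩, fun z hz => ?_⟩
    by_contra h2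
    have h3 := hz.2
    rw [hu z hz.1 h2] at h3
    simp at h3
  rw [hears, if_neg (by simp [hx]), dif_pos h1]
  exact congrArg sent (h1.unique h1.choose_spec.1 ⟨hxy, hy⟩)

namespace Setting

variable {V : Type v} [Fintype V] {M : Type u}

section Events

variable {A : Algorithm V M} {X : Setting A} {h : X.History} {ρ : Round X.P}

theorem getElem?_concat_iff {α : Type w} {l : List α} {a b : α} {t : ℕ} :
    (l ++ [a])[t]? = some b ↔ l[t]? = some b ∨ t = l.length ∧ a = b := by
  rcases lt_trichotomy t l.length with ht | ht | ht
  · rw [List.getElem?_append_left ht]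
    exact ⟨Or.inl, fun h => h.elim id fun h => absurd h.1 ht.ne⟩
  · subst ht
    simp
  · rw [List.getElem?_eq_none (by simp; omega), List.getElem?_eq_none (by omega)]
    simp [ht.ne']

theorem bcastAt_concat {t : ℕ} {x : V} {m : M} : X.BcastAt (h ++ [ρ]) t x m ↔
    X.BcastAt h t x m ∨ t = h.length ∧ ρ.bcast x = some m := by
  simp only [BcastAt, getElem?_concat_iff, or_and_right, exists_or]
  simp

theorem rcvAt_concat {t : ℕ} {x : V} {m : M} : X.RcvAt (h ++ [ρ]) t x m ↔
    X.RcvAt h t x m ∨ t = h.length ∧ ρ.rcv x = some m := by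
  simp only [RcvAt, getElem?_concat_iff, or_and_right, exists_or]
  simp

theorem ackAt_concat {t : ℕ} {x : V} {m : M} : X.AckAt (h ++ [ρ]) t x m ↔
    X.AckAt h t x m ∨ t = h.length ∧ ρ.ack x = some m := by
  simp only [AckAt, getElem?_concat_iff, or_and_right, exists_or]
  simp

theorem BcastAt.lt {t : ℕ} {x : V} {m : M} (hb : X.BcastAt h t x m) : t < h.length :=
  (List.getElem?_eq_some_iff.1 hb.choose_spec.1).1

theorem RcvAt.lt {t : ℕ} {x : V} {m : M} (hb : X.RcvAt h t x m) : t < h.length :=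
  (List.getElem?_eq_some_iff.1 hb.choose_spec.1).1

theorem AckAt.lt {t : ℕ} {x : V} {m : M} (hb : X.AckAt h t x m) : t < h.length :=
  (List.getElem?_eq_some_iff.1 hb.choose_spec.1).1

theorem bcastAt_take {n t : ℕ} {x : V} {m : M} :
    X.BcastAt (h.take n) t x m ↔ t < n ∧ X.BcastAt h t x m := by
  by_cases ht : t < n
  · simp [BcastAt, ht]
  · simp [BcastAt, ht]

theorem rcvAt_take {n t : ℕ} {x : V} {m : M} :
    X.RcvAt (h.take n) t x m ↔ t < n ∧ X.RcvAt h t x m := by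
  by_cases ht : t < n
  · simp [RcvAt, ht]
  · simp [RcvAt, ht]

theorem ackAt_take {n t : ℕ} {x : V} {m : M} :
    X.AckAt (h.take n) t x m ↔ t < n ∧ X.AckAt h t x m := by
  by_cases ht : t < n
  · simp [AckAt, ht]
  · simp [AckAt, ht]

end Events

/-! ### One step of an interleaving -/

variable {P Q : Protocol} (X : Setting fun _ : Fin (Fintype.card V) => interleave P Q M)

/-- The state of the process at node `x` after the history `h`. -/
def localState (h : X.History) (x : V) : InterleaveState M := X.stateAfter h x

/-- The message on which node `x` works in the round that follows `h`, with the index of the round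
of its input. -/
def current (h : X.History) (x : V) : Option (M × ℕ) :=
  match X.env h x with
  | some m => some (m, (X.localState h x).clock)
  | none => (X.localState h x).pending

/-- The relation between a history and the round that follows. -/
structure IsStep (h : X.History) (ρ : Round X.P) : Prop where
  bcast : ρ.bcast = X.env h
  le_reach : X.G ≤ ρ.reach
  reach_le : ρ.reach ≤ X.G'
  heard : ρ.heard = hears ρ.reach ρ.sent
  sent : ∀ x m, ρ.sent x = some m → ∃ t₀, X.current h x = some (m, t₀) ∧
    (interleaveLevel P Q t₀ (X.localState h x).clock).isSome
  clock : ∀ x, (X.localState (h ++ [ρ]) x).clock = (X.localState h x).clock + 1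
  pending : ∀ x, (X.localState (h ++ [ρ]) x).pending =
    if (ρ.ack x).isSome then none else X.current h x
  received : ∀ x, (X.localState (h ++ [ρ]) x).received =
    (X.localState h x).received ∪ {m | ρ.rcv x = some m}
  rcv : ∀ x m, ρ.rcv x = some m ↔ ρ.heard x = some m ∧ m ∉ (X.localState h x).received ∧
    ∀ q ∈ X.current h x, q.1 ≠ m
  ack : ∀ x m, ρ.ack x = some m ↔ ∃ t₀, X.current h x = some (m, t₀) ∧
    Even (X.localState h x).clock ∧ P.acks (t₀ / 2 + 1) ((X.localState h x).clock / 2)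

theorem localState_concat (h : X.History) (ρ : Round X.P) (x : V) :
    X.localState (h ++ [ρ]) x = ρ.state x := by
  simp [localState, stateAfter]
  rfl

theorem send_current (h : X.History) (x : V) :
    (X.P x).send (X.stateAfter h x) (X.env h x) =
      let σ' : InterleaveState M := { X.localState h x with pending := X.current h x }
      match X.current h x with
      | none => PMF.pure (σ', none)
      | some (m, t₀) =>
        match interleaveLevel P Q t₀ (X.localState h x).clock with
        | none => PMF.pure (σ', none)
        | some i => (coin i).map fun b => (σ', if b then some m else none) := rfl

theorem of_mem_support_send {h : X.History} {x : V} {c : (X.P x).State × Option M}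
    (hc : c ∈ ((X.P x).send (X.stateAfter h x) (X.env h x)).support) :
    c.1 = ({ X.localState h x with pending := X.current h x } : InterleaveState M) ∧
      ∀ m, c.2 = some m → ∃ t₀, X.current h x = some (m, t₀) ∧
        (interleaveLevel P Q t₀ (X.localState h x).clock).isSome := by
  rw [send_current] at hc
  dsimp only at hc
  split at hc
  · obtain rfl := (PMF.mem_support_pure_iff _ _).1 hc
    exact ⟨rfl, fun m hm => by simp at hm⟩
  · rename_i m t₀ hcur
    split at hc
    · obtain rfl := (PMF.mem_support_pure_iff _ _).1 hc
      exact ⟨rfl, fun m hm => by simp at hm⟩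
    · rename_i i hi
      obtain ⟨b, -, rfl⟩ := (PMF.mem_support_map_iff _ _ _).1 hc
      refine ⟨rfl, fun m' hm => ?_⟩
      cases b
      · simp at hm
      · obtain rfl : m = m' := by simpa using hm
        exact ⟨t₀, hcur, by simp [hi]⟩

/-- Sample-path arguments need only these facts about a round of positive probability; the coins
return only in `send_dist`. -/
theorem isStep_of_mem_support {h : X.History} {ρ : Round X.P}
    (hρ : ρ ∈ (X.roundDist h).support) : X.IsStep h ρ := by
  classical
  obtain ⟨c, hc, rfl⟩ := (PMF.mem_support_map_iff _ _ _).1 hρ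
  have hc' := fun x => X.of_mem_support_send (apply_mem_support_of_independent _ hc x)
  have hsend : ∀ x, (c x).1 = _ := fun x => (hc' x).1
  refine ⟨rfl, X.le_adv _ _ _ _, X.adv_le _ _ _ _, rfl, fun x => (hc' x).2, ?_, ?_, ?_, ?_, ?_⟩
  · intro x
    rw [localState_concat]
    show ((X.P x).receive (c x).1 ((X.nextRound h c).heard x)).1.clock = _
    rw [hsend x]
    rfl
  · intro x
    rw [localState_concat]
    show ((X.P x).receive (c x).1 ((X.nextRound h c).heard x)).1.pending =
      if (((X.P x).receive (c x).1 ((X.nextRound h c).heard x)).2.2).isSome then _ else _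
    rw [hsend x]
    rfl
  · intro x
    rw [localState_concat]
    show ((X.P x).receive (c x).1 ((X.nextRound h c).heard x)).1.received =
      _ ∪ {m | ((X.P x).receive (c x).1 ((X.nextRound h c).heard x)).2.1 = some m}
    rw [hsend x]
    rfl
  · intro x m
    show ((X.P x).receive (c x).1 ((X.nextRound h c).heard x)).2.1 = some m ↔ _
    rw [hsend x]
    refine Option.filter_eq_some_iff.trans ?_
    simp only [decide_eq_true_eq]
  · intro x m
    show ((X.P x).receive (c x).1 ((X.nextRound h c).heard x)).2.2 = some m ↔ _
    rw [hsend x]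
    refine Option.map_eq_some_iff.trans ?_
    simp only [Option.filter_eq_some_iff, decide_eq_true_eq]
    constructor
    · rintro ⟨⟨m', t₀⟩, ⟨h1, h2, h3⟩, rfl⟩
      exact ⟨t₀, h1, h2, h3⟩
    · rintro ⟨t₀, h1, h2, h3⟩
      exact ⟨(m, t₀), ⟨h1, h2, h3⟩, rfl⟩

end Setting

/-! ### The invariant that links states to past events -/

namespace Setting

variable {V : Type v} [Fintype V] {M : Type u}
variable {P Q : Protocol} {X : Setting fun _ : Fin (Fintype.card V) => interleave P Q M}

/-- What the state of node `x` says about the history `h`. -/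
structure Invariant (X : Setting fun _ : Fin (Fintype.card V) => interleave P Q M)
    (h : X.History) (x : V) : Prop where
  clock : (X.localState h x).clock = h.length
  bcast_of_pending : ∀ m t₀, (X.localState h x).pending = some (m, t₀) → X.BcastAt h t₀ x m
  not_ack_of_pending : ∀ m t₀, (X.localState h x).pending = some (m, t₀) →
    ∀ s m', t₀ ≤ s → ¬ X.AckAt h s x m'
  not_acks_of_pending : ∀ m t₀, (X.localState h x).pending = some (m, t₀) →
    ∀ s, t₀ ≤ s → s < h.length → Even s → ¬ P.acks (t₀ / 2 + 1) (s / 2)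
  pending_or_ack : ∀ m t₀, X.BcastAt h t₀ x m →
    (X.localState h x).pending = some (m, t₀) ∨ ∃ s ≥ t₀, X.AckAt h s x m
  bcast_of_ack : ∀ m s, X.AckAt h s x m → ∃ t₀ ≤ s, X.BcastAt h t₀ x m
  ack_unique : ∀ m s s', X.AckAt h s x m → X.AckAt h s' x m → s = s'
  mem_received : ∀ m, m ∈ (X.localState h x).received ↔ ∃ s, X.RcvAt h s x m
  rcv_unique : ∀ m s s', X.RcvAt h s x m → X.RcvAt h s' x m → s = s'

theorem current_spec {h : X.History} {ρ : Round X.P} {x : V} (hρ : X.IsStep h ρ)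
    (hi : X.Invariant h x) {m : M} {t₀ : ℕ} (hc : X.current h x = some (m, t₀)) :
    X.BcastAt (h ++ [ρ]) t₀ x m ∧ (∀ s m', t₀ ≤ s → ¬ X.AckAt h s x m') ∧
      ∀ s, t₀ ≤ s → s < h.length → Even s → ¬ P.acks (t₀ / 2 + 1) (s / 2) := by
  unfold current at hc
  split at hc
  · rename_i m' henv
    simp only [Option.some.injEq, Prod.mk.injEq] at hc
    obtain ⟨rfl, rfl⟩ := hc
    rw [hi.clock]
    refine ⟨bcastAt_concat.2 (Or.inr ⟨rfl, by rw [hρ.bcast, henv]⟩), fun s m' hs ha => ?_,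
      fun s h1 h2 => by omega⟩
    have := ha.lt
    omega
  · exact ⟨bcastAt_concat.2 (Or.inl (hi.bcast_of_pending m t₀ hc)), hi.not_ack_of_pending m t₀ hc,
      hi.not_acks_of_pending m t₀ hc⟩

/-- Here well-formedness matters: a new input overwrites the pending message, so nothing may be
pending when it comes. -/
theorem current_or_ack {h : X.History} {ρ : Round X.P} {x : V} (hρ : X.IsStep h ρ)
    (hwf : X.WellFormed) (hr : X.Reachable (h ++ [ρ])) (hi : X.Invariant h x) {m : M} {t₀ : ℕ}
    (hb : X.BcastAt (h ++ [ρ]) t₀ x m) :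
    X.current h x = some (m, t₀) ∨ ∃ s ≥ t₀, X.AckAt h s x m := by
  rcases henv : X.env h x with _ | m'
  · have hc : X.current h x = (X.localState h x).pending := by simp [current, henv]
    rcases bcastAt_concat.1 hb with h1 | ⟨h1, h2⟩
    · rw [hc]
      exact hi.pending_or_ack m t₀ h1
    · rw [hρ.bcast, henv] at h2
      simp at h2
  · have hc : X.current h x = some (m', h.length) := by simp [current, henv, hi.clock]
    have hb' : X.BcastAt (h ++ [ρ]) h.length x m' :=
      bcastAt_concat.2 (Or.inr ⟨rfl, by rw [hρ.bcast, henv]⟩)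
    rcases bcastAt_concat.1 hb with h1 | ⟨h1, h2⟩
    · refine (hi.pending_or_ack m t₀ h1).imp (fun h2 => ?_) id
      obtain ⟨q, m'', h3, h4, h5⟩ := (hwf _ hr).2 t₀ h.length x m m' h1.lt hb hb'
      rcases ackAt_concat.1 h5 with h6 | h6
      · exact absurd h6 (hi.not_ack_of_pending m t₀ h2 q m'' h3)
      · omega
    · rw [hρ.bcast, henv] at h2
      rw [hc, h1, Option.some.inj h2]
      exact Or.inl rfl

theorem Invariant.concat {h : X.History} {ρ : Round X.P} {x : V} (hρ : X.IsStep h ρ)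
    (hwf : X.WellFormed) (hr : X.Reachable (h ++ [ρ])) (hi : X.Invariant h x) :
    X.Invariant (h ++ [ρ]) x := by
  have hpend : ∀ m t₀, (X.localState (h ++ [ρ]) x).pending = some (m, t₀) →
      ρ.ack x = none ∧ X.current h x = some (m, t₀) := by
    intro m t₀ hp
    rw [hρ.pending] at hp
    split_ifs at hp with h1
    exact ⟨by simpa using h1, hp⟩
  have hack : ∀ m, ρ.ack x = some m → ∃ t₀, X.current h x = some (m, t₀) ∧
      Even h.length ∧ P.acks (t₀ / 2 + 1) (h.length / 2) := by
    intro m hm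
    have := (hρ.ack x m).1 hm
    rwa [hi.clock] at this
  -- An earlier acknowledgment of `m` would follow an input of `m`, which is the only one and hence
  -- the input at `t₀`; but nothing was acknowledged from `t₀` on.
  have hnew : ∀ m s, ρ.ack x = some m → ¬ X.AckAt h s x m := by
    intro m s hm hs
    obtain ⟨t₀, h1, -, -⟩ := hack m hm
    obtain ⟨h2, h3, -⟩ := current_spec hρ hi h1
    obtain ⟨t, h4, h5⟩ := hi.bcast_of_ack m s hs
    have h6 := ((hwf _ hr).1 t t₀ x x m (bcastAt_concat.2 (Or.inl h5)) h2).1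
    exact h3 s m (by omega) hs
  have hrnew : ∀ m s, ρ.rcv x = some m → ¬ X.RcvAt h s x m := by
    intro m s hm hs
    exact ((hρ.rcv x m).1 hm).2.1 ((hi.mem_received m).2 ⟨s, hs⟩)
  constructor
  · rw [hρ.clock, hi.clock]; simp
  · intro m t₀ hp
    exact (current_spec hρ hi (hpend m t₀ hp).2).1
  · intro m t₀ hp s m' hs ha
    obtain ⟨h1, h2⟩ := hpend m t₀ hp
    rcases ackAt_concat.1 ha with h3 | ⟨-, h3⟩
    · exact (current_spec hρ hi h2).2.1 s m' hs h3
    · rw [h1] at h3; simp at h3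
  · intro m t₀ hp s hs hlt he ha
    obtain ⟨h1, h2⟩ := hpend m t₀ hp
    by_cases h3 : s < h.length
    · exact (current_spec hρ hi h2).2.2 s hs h3 he ha
    · obtain rfl : s = h.length := by simp at hlt; omega
      have := (hρ.ack x m).2 ⟨t₀, h2, by rwa [hi.clock], by rwa [hi.clock]⟩
      rw [h1] at this
      simp at this
  · intro m t₀ hb
    rcases current_or_ack hρ hwf hr hi hb with h1 | ⟨s, h1, h2⟩
    · rcases ho : ρ.ack x with _ | m'
      · left
        rw [hρ.pending, ho]
        simpa using h1
      · obtain ⟨t₁, h2, -, -⟩ := hack m' ho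
        rw [h1] at h2
        simp only [Option.some.injEq, Prod.mk.injEq] at h2
        obtain ⟨rfl, rfl⟩ := h2
        refine Or.inr ⟨h.length, ?_, ackAt_concat.2 (Or.inr ⟨rfl, ho⟩)⟩
        have := hb.lt
        simp at this
        omega
    · exact Or.inr ⟨s, h1, ackAt_concat.2 (Or.inl h2)⟩
  · intro m s ha
    rcases ackAt_concat.1 ha with h1 | ⟨rfl, h1⟩
    · obtain ⟨t₀, h2, h3⟩ := hi.bcast_of_ack m s h1
      exact ⟨t₀, h2, bcastAt_concat.2 (Or.inl h3)⟩
    · obtain ⟨t₀, h2, -, -⟩ := hack m h1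
      have h3 := (current_spec hρ hi h2).1
      refine ⟨t₀, ?_, h3⟩
      have := h3.lt
      simp at this
      omega
  · intro m s s' hs hs'
    rcases ackAt_concat.1 hs with h1 | ⟨rfl, h1⟩ <;> rcases ackAt_concat.1 hs' with h2 | ⟨rfl, h2⟩
    · exact hi.ack_unique m s s' h1 h2
    · exact absurd h1 (hnew m s h2)
    · exact absurd h2 (hnew m s' h1)
    · rfl
  · intro m
    rw [hρ.received]
    simp only [Set.mem_union, Set.mem_ofPred_eq, hi.mem_received, rcvAt_concat, exists_or]
    simp
  · intro m s s' hs hs'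
    rcases rcvAt_concat.1 hs with h1 | ⟨rfl, h1⟩ <;> rcases rcvAt_concat.1 hs' with h2 | ⟨rfl, h2⟩
    · exact hi.rcv_unique m s s' h1 h2
    · exact absurd h1 (hrnew m s h2)
    · exact absurd h2 (hrnew m s' h1)
    · rfl

theorem invariant_of_reachable (hwf : X.WellFormed) {h : X.History} (hr : X.Reachable h) (x : V) :
    X.Invariant h x := by
  refine Reachable.induction (C := fun h => X.Invariant h x) ?_ ?_ hr
  · have hb : ∀ t m, ¬ X.BcastAt [] t x m := fun t m hb => absurd hb.lt (by simp)
    have ha : ∀ t m, ¬ X.AckAt [] t x m := fun t m ha => absurd ha.lt (by simp)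
    have hc : ∀ t m, ¬ X.RcvAt [] t x m := fun t m hc => absurd hc.lt (by simp)
    have hp : ∀ q, (X.localState [] x).pending ≠ some q := fun q hq => by
      have hq' : (none : Option (M × ℕ)) = some q := hq
      simp at hq'
    exact ⟨rfl, fun m t₀ h => absurd h (hp _), fun m t₀ h => absurd h (hp _),
      fun m t₀ h => absurd h (hp _), fun m t₀ h => absurd h (hb _ _),
      fun m s h => absurd h (ha _ _), fun m s s' h => absurd h (ha _ _),
      fun m => ⟨fun h => absurd h (Set.notMem_empty m), fun ⟨s, h⟩ => absurd h (hc _ _)⟩,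
      fun m s s' h => absurd h (hc _ _)⟩
  · intro h ρ h1 h2 ih
    exact ih.concat (X.isStep_of_mem_support h2) hwf (X.reachable_append_singleton.2 ⟨h1, h2⟩)

/-! ### The events of a round -/

theorem current_take (hwf : X.WellFormed) {h : X.History} (hr : X.Reachable h) {t : ℕ}
    (ht : t < h.length) {x : V} {m : M} {t₀ : ℕ} (hc : X.current (h.take t) x = some (m, t₀)) :
    t₀ ≤ t ∧ X.BcastAt h t₀ x m ∧ (∀ s m', t₀ ≤ s → s < t → ¬ X.AckAt h s x m') ∧
      ∀ s, t₀ ≤ s → s < t → Even s → ¬ P.acks (t₀ / 2 + 1) (s / 2) := by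
  obtain ⟨h1, h2⟩ := hr.take_succ (List.getElem?_eq_getElem ht)
  obtain ⟨h3, h4, h5⟩ := current_spec (X.isStep_of_mem_support h2)
    (invariant_of_reachable hwf (hr.take t) x) hc
  rw [← h1, bcastAt_take] at h3
  refine ⟨by omega, h3.2, fun s m' hs hst ha => h4 s m' hs (ackAt_take.2 ⟨hst, ha⟩),
    fun s hs hst => h5 s hs ?_⟩
  rw [List.length_take]
  omega

/-- The dictionary between the observable notion of activity and the internal state that governs
sending. -/
theorem activeWith_iff_current (hwf : X.WellFormed) {h : X.History} (hr : X.Reachable h) {t : ℕ}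
    (ht : t < h.length) {x : V} {m : M} :
    X.ActiveWith h t x m ↔ ∃ t₀, X.current (h.take t) x = some (m, t₀) := by
  constructor
  · rintro ⟨⟨t₀, h1, h2⟩, h3⟩
    obtain ⟨h4, h5⟩ := hr.take_succ (List.getElem?_eq_getElem ht)
    rcases current_or_ack (X.isStep_of_mem_support h5) hwf (h4 ▸ hr.take (t + 1))
      (invariant_of_reachable hwf (hr.take t) x)
      (by rw [← h4, bcastAt_take]; exact ⟨by omega, h2⟩) with h6 | ⟨s, h6, h7⟩
    · exact ⟨t₀, h6⟩
    · exact absurd (ackAt_take.1 h7).2 (h3 s (ackAt_take.1 h7).1)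
  · rintro ⟨t₀, hc⟩
    obtain ⟨h1, h2, h3, -⟩ := current_take hwf hr ht hc
    refine ⟨⟨t₀, h1, h2⟩, fun s hs ha => ?_⟩
    obtain ⟨t, h4, h5⟩ := (invariant_of_reachable hwf hr x).bcast_of_ack m s ha
    obtain rfl := ((hwf _ hr).1 t t₀ x x m h5 h2).1
    exact h3 s m h4 hs ha

theorem current_of_ackAt (hwf : X.WellFormed) {h : X.History} (hr : X.Reachable h) {s : ℕ} {x : V}
    {m : M} (ha : X.AckAt h s x m) : ∃ t₀, X.current (h.take s) x = some (m, t₀) ∧ Even s ∧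
      P.acks (t₀ / 2 + 1) (s / 2) := by
  have hlt := ha.lt
  obtain ⟨ρ, h1, h2⟩ := ha
  obtain ⟨h3, h4⟩ := hr.take_succ h1
  have h5 := ((X.isStep_of_mem_support h4).ack x m).1 h2
  rw [(invariant_of_reachable hwf (hr.take s) x).clock, List.length_take,
    min_eq_left hlt.le] at h5
  exact h5

theorem activeWith_of_sent (hwf : X.WellFormed) {h : X.History} (hr : X.Reachable h) {t : ℕ}
    {ρ : Round X.P} (hρ : h[t]? = some ρ) {y : V} {m : M} (hs : ρ.sent y = some m) :
    X.ActiveWith h t y m ∧ ∃ t₀, X.current (h.take t) y = some (m, t₀) ∧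
      (interleaveLevel P Q t₀ t).isSome := by
  have ht := (List.getElem?_eq_some_iff.1 hρ).1
  obtain ⟨t₀, h1, h2⟩ := (X.isStep_of_mem_support (hr.take_succ hρ).2).sent y m hs
  rw [(invariant_of_reachable hwf (hr.take t) y).clock, List.length_take, min_eq_left ht.le] at h2
  exact ⟨(activeWith_iff_current hwf hr ht).2 ⟨t₀, h1⟩, t₀, h1, h2⟩

theorem sender_unique (hwf : X.WellFormed) {h : X.History} (hr : X.Reachable h) {t t' : ℕ}
    {y y' : V} {m : M} (h1 : X.ActiveWith h t y m) (h2 : X.ActiveWith h t' y' m) : y = y' := by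
  obtain ⟨⟨s, -, hs⟩, -⟩ := h1
  obtain ⟨⟨s', -, hs'⟩, -⟩ := h2
  exact ((hwf _ hr).1 s s' y y' m hs hs').2

/-- A message that is heard from another node is output, unless this has been done before. -/
theorem exists_rcvAt_of_heard (hwf : X.WellFormed) {h : X.History} (hr : X.Reachable h) {t : ℕ}
    {ρ : Round X.P} (hρ : h[t]? = some ρ) {x y : V} {m : M} (hxy : x ≠ y)
    (hs : ρ.sent y = some m) (hx : ρ.heard x = some m) : ∃ s ≤ t, X.RcvAt h s x m := by
  have ht := (List.getElem?_eq_some_iff.1 hρ).1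
  have hst := X.isStep_of_mem_support (hr.take_succ hρ).2
  by_cases hm : m ∈ (X.localState (h.take t) x).received
  · obtain ⟨s, hs⟩ := ((invariant_of_reachable hwf (hr.take t) x).mem_received m).1 hm
    rw [rcvAt_take] at hs
    exact ⟨s, by omega, hs.2⟩
  · refine ⟨t, le_rfl, ρ, hρ, (hst.rcv x m).2 ⟨hx, hm, ?_⟩⟩
    -- The output is also suppressed for a message that `x` broadcasts itself, but `m` has only one
    -- broadcaster, namely `y`.
    rintro ⟨m', t₀⟩ hq rfl
    exact hxy (sender_unique hwf hr ((activeWith_iff_current hwf hr ht).2 ⟨t₀, hq⟩)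
      (activeWith_of_sent hwf hr hρ hs).1)

theorem exists_sender_of_rcvAt {h : X.History} (hr : X.Reachable h) {t : ℕ}
    {ρ : Round X.P} (hρ : h[t]? = some ρ) {x : V} {m : M} (hx : ρ.rcv x = some m) :
    ∃ y, X.G'.Adj x y ∧ ρ.sent y = some m := by
  have hst := X.isStep_of_mem_support (hr.take_succ hρ).2
  obtain ⟨h1, -, h3⟩ := (hst.rcv x m).1 hx
  rw [hst.heard] at h1
  rcases hsx : ρ.sent x with _ | m'
  · obtain ⟨y, h4, h5⟩ := exists_adj_of_hears hsx h1
    exact ⟨y, hst.reach_le h4, h5⟩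
  -- A sending node hears its own message, which it never outputs.
  · rw [hears_of_isSome (by simp [hsx])] at h1
    obtain ⟨t₀, h4, -⟩ := hst.sent x m h1
    exact absurd rfl (h3 _ h4)

end Setting

/-! ### The probability of a hit in a single round -/

theorem quarter_le_one_sub_pow {i k : ℕ} (hi : 1 ≤ i) (hk : k ≤ 2 ^ i) :
    (1 / 4 : ℝ) ≤ (1 - (1 / 2) ^ i) ^ k := by
  obtain ⟨j, rfl⟩ : ∃ j, i = j + 1 := ⟨i - 1, by omega⟩
  have h1 : (0 : ℝ) < 2 ^ j := by positivity
  have h2 : ((1 / 2 : ℝ)) ^ (j + 1) * 2 ^ j = 1 / 2 := by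
    rw [pow_succ, one_div, inv_pow]
    field_simp
  have h3 : ((1 / 2 : ℝ)) ^ (j + 1) ≤ 1 := pow_le_one₀ (by norm_num) (by norm_num)
  -- Bernoulli's inequality with half of the exponent `2 ^ (j + 1)`; squaring then gives `1 / 4`.
  -- The full exponent would only give `0`.
  have h4 : (1 / 2 : ℝ) ≤ (1 - (1 / 2) ^ (j + 1)) ^ (2 ^ j) := by
    have := one_add_mul_le_pow (a := -((1 / 2 : ℝ)) ^ (j + 1)) (by linarith) (2 ^ j)
    rw [← sub_eq_add_neg 1] at this
    refine le_trans ?_ this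
    push_cast
    nlinarith
  calc (1 / 4 : ℝ) = (1 / 2) * (1 / 2) := by norm_num
    _ ≤ (1 - (1 / 2) ^ (j + 1)) ^ (2 ^ j) * (1 - (1 / 2) ^ (j + 1)) ^ (2 ^ j) := by gcongr
    _ = (1 - (1 / 2) ^ (j + 1)) ^ (2 ^ (j + 1)) := by rw [← pow_add]; congr 1; ring
    _ ≤ _ := pow_le_pow_of_le_one (by linarith) (by simp) hk

theorem coin_true (i : ℕ) : coin i true = ENNReal.ofReal ((1 / 2) ^ i) := by
  rw [ENNReal.ofReal_pow (by norm_num), one_div, ENNReal.ofReal_inv_of_pos (by norm_num)]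
  simp [coin]

theorem coin_false (i : ℕ) : coin i false = ENNReal.ofReal (1 - (1 / 2) ^ i) := by
  rw [ENNReal.ofReal_sub _ (by positivity), ENNReal.ofReal_pow (by norm_num), one_div,
    ENNReal.ofReal_inv_of_pos (by norm_num)]
  simp [coin]

/-- Disjoint events, each of probability at least `w`. -/
theorem card_mul_le_toOuterMeasure {α : Type w} {β : Type v} (p : PMF α) (Y : Finset β)
    (B : β → Set α) (hB : ∀ y ∈ Y, ∀ y' ∈ Y, ∀ a, a ∈ B y → a ∈ B y' → y = y') (S : Set α)
    (hS : ∀ y ∈ Y, B y ⊆ S) (w : ℝ≥0∞) (hw : ∀ y ∈ Y, w ≤ p.toOuterMeasure (B y)) :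
    Y.card * w ≤ p.toOuterMeasure S := by
  classical
  rw [← nsmul_eq_mul]
  refine (Finset.card_nsmul_le_sum Y _ w hw).trans ?_
  simp_rw [PMF.toOuterMeasure_apply]
  rw [← Summable.tsum_finsetSum fun _ _ => ENNReal.summable]
  refine ENNReal.tsum_le_tsum fun a => ?_
  by_cases ha : ∃ y ∈ Y, a ∈ B y
  · obtain ⟨y, hy, hay⟩ := ha
    rw [Finset.sum_eq_single_of_mem y hy, Set.indicator_of_mem hay,
      Set.indicator_of_mem (hS y hy hay)]
    intro y' hy' hne
    exact Set.indicator_of_notMem (fun h => hne (hB y' hy' y hy a h hay)) _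
  · push Not at ha
    rw [Finset.sum_eq_zero fun y hy => Set.indicator_of_notMem (ha y hy) _]
    exact zero_le

namespace Setting

variable {V : Type v} [Fintype V] {M : Type u}

/-- Node `x` hears a message from a neighbour in `T`. -/
def Hit {A : Algorithm V M} (X : Setting A) (T : Set V) (x : V) (ρ : Round X.P) : Prop :=
  ∃ y ∈ T, X.G.Adj x y ∧ (ρ.sent y).isSome ∧ ρ.heard x = ρ.sent y

variable {P Q : Protocol} (X : Setting fun _ : Fin (Fintype.card V) => interleave P Q M)

/-- Node `z` sends with positive probability in the round that follows `h`. -/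
def Participates (h : X.History) (z : V) : Prop :=
  ∃ m t₀, X.current h z = some (m, t₀) ∧ (interleaveLevel P Q t₀ h.length).isSome

open Classical in
/-- The participating `G'`-neighbours of `x`. -/
def participants (h : X.History) (x : V) : Finset V :=
  Finset.univ.filter fun z => X.G'.Adj x z ∧ X.Participates h z

open Classical in
/-- The participating `G`-neighbours of `x` in `T`. -/
def targets (T : Set V) (h : X.History) (x : V) : Finset V :=
  Finset.univ.filter fun z => z ∈ T ∧ X.G.Adj x z ∧ X.Participates h z

variable {X} in
theorem mem_participants {h : X.History} {x z : V} :
    z ∈ X.participants h x ↔ X.G'.Adj x z ∧ X.Participates h z := by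
  simp [participants]

variable {X} in
theorem mem_targets {T : Set V} {h : X.History} {x z : V} :
    z ∈ X.targets T h x ↔ z ∈ T ∧ X.G.Adj x z ∧ X.Participates h z := by
  simp [targets]

theorem targets_subset (T : Set V) (h : X.History) (x : V) :
    X.targets T h x ⊆ X.participants h x := by
  intro z hz
  rw [mem_targets] at hz
  rw [mem_participants]
  exact ⟨X.le hz.2.1, hz.2.2⟩

variable {X}

/-- The assumption `hi` expresses that the level depends on the round alone and not on the message,
so that all participants toss the same coin. -/
theorem send_dist {h : X.History} (hclock : ∀ x, (X.localState h x).clock = h.length)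
    {i : ℕ} (hi : ∀ t₀ j, interleaveLevel P Q t₀ h.length = some j → j = i) (z : V) :
    (X.Participates h z ∧
      ((X.P z).send (X.stateAfter h z) (X.env h z)).toOuterMeasure {c | c.2.isSome} =
        ENNReal.ofReal ((1 / 2) ^ i) ∧
      ((X.P z).send (X.stateAfter h z) (X.env h z)).toOuterMeasure {c | c.2 = none} =
        ENNReal.ofReal (1 - (1 / 2) ^ i)) ∨
    (¬ X.Participates h z ∧
      ((X.P z).send (X.stateAfter h z) (X.env h z)).toOuterMeasure {c | c.2 = none} = 1) := by
  rw [send_current, hclock]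
  dsimp only
  split
  · rename_i hc
    right
    refine ⟨?_, (PMF.toOuterMeasure_pure_apply _ _).trans (if_pos rfl)⟩
    rintro ⟨m, t₀, h1, -⟩
    rw [hc] at h1
    simp at h1
  · rename_i m t₀ hc
    split
    · rename_i hl
      right
      refine ⟨?_, (PMF.toOuterMeasure_pure_apply _ _).trans (if_pos rfl)⟩
      rintro ⟨m', t₁, h1, h2⟩
      rw [hc] at h1
      simp only [Option.some.injEq, Prod.mk.injEq] at h1
      rw [← h1.2, hl] at h2
      simp at h2
    · rename_i j hl
      left
      obtain rfl := hi t₀ j hl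
      refine ⟨⟨m, t₀, hc, by rw [hl]; rfl⟩, ?_, ?_⟩
      · rw [PMF.toOuterMeasure_map_apply, ← coin_true, ← PMF.toOuterMeasure_apply_singleton]
        congr 1
        ext b
        cases b <;> simp
      · rw [PMF.toOuterMeasure_map_apply, ← coin_false, ← PMF.toOuterMeasure_apply_singleton]
        congr 1
        ext b
        cases b <;> simp

/-- A lower bound on the probability that `x` hears a message from `T` in the next round. -/
theorem le_prob_hit {h : X.History} (hclock : ∀ x, (X.localState h x).clock = h.length)
    {i : ℕ} (hi : ∀ t₀ j, interleaveLevel P Q t₀ h.length = some j → j = i) (hi1 : 1 ≤ i)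
    (T : Set V) (x : V) (hK : (X.participants h x).card ≤ 2 ^ i) :
    ENNReal.ofReal ((X.targets T h x).card * (1 / 2) ^ i / 4) ≤
      (X.roundDist h).toOuterMeasure {ρ | X.Hit T x ρ} := by
  classical
  set K := X.participants h x with hKdef
  -- The box in which `y` sends and `x` and all its other `G'`-neighbours are silent. It constrains
  -- `G'`-neighbours rather than neighbours in the reach set, which the adversary chooses after the
  -- coins.
  let S : V → ∀ z, Set ((X.P z).State × Option M) := fun y z =>
    if z = y then {c | c.2.isSome} else if z = x ∨ X.G'.Adj x z then {c | c.2 = none}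
    else Set.univ
  have hsent : ∀ y (c : ∀ z, (X.P z).State × Option M), (∀ z, c z ∈ S y z) → (c y).2.isSome := by
    intro y c hc
    have := hc y
    simp only [S, if_true] at this
    exact this
  have hsilent : ∀ y (c : ∀ z, (X.P z).State × Option M), (∀ z, c z ∈ S y z) →
      ∀ z, z ≠ y → z = x ∨ X.G'.Adj x z → (c z).2 = none := by
    intro y c hc z hz hxz
    have := hc z
    simp only [S, if_neg hz, if_pos hxz] at this
    exact this
  rw [roundDist, PMF.toOuterMeasure_map_apply, mul_div_assoc, ENNReal.ofReal_mul (by positivity),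
    ENNReal.ofReal_natCast]
  refine card_mul_le_toOuterMeasure _ (X.targets T h x) (fun y => {c | ∀ z, c z ∈ S y z}) ?_ _ ?_ _
    ?_
  · intro y hy y' hy' c hc hc'
    by_contra hne
    have h1 := hsilent y' c hc' y hne
      (Or.inr (mem_participants.1 (X.targets_subset T h x hy)).1)
    have h2 := hsent y c hc
    rw [h1] at h2
    simp at h2
  · intro y hy c hc
    obtain ⟨hyT, hadj, -⟩ := mem_targets.1 hy
    refine ⟨y, hyT, hadj, hsent y c hc, ?_⟩
    exact hears_eq_of_unique (R := (X.nextRound h c).reach) (sent := fun z => (c z).2)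
      (hsilent y c hc x hadj.ne (Or.inl rfl)) (X.le_adv _ _ _ _ hadj)
      (hsent y c hc) fun z hz hzy => hsilent y c hc z hzy (Or.inr (X.adv_le _ _ _ _ hz))
  · intro y hy
    have hyK := X.targets_subset T h x hy
    have hxy : x ≠ y := (mem_participants.1 hyK).1.ne
    have hxK : x ∉ K := fun h => (mem_participants.1 h).1.ne rfl
    rw [toOuterMeasure_independent_pi]
    -- Here `x` is charged as if it participated. It takes the place of `y` among the silent nodes,
    -- so the exponent is exactly `K.card`.
    let g : V → ℝ≥0∞ := fun z => if z = y then ENNReal.ofReal ((1 / 2) ^ i) else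
      if z ∈ insert x K then ENNReal.ofReal (1 - (1 / 2) ^ i) else 1
    have hp1 : ((1 / 2 : ℝ)) ^ i ≤ 1 := pow_le_one₀ (by norm_num) (by norm_num)
    calc ENNReal.ofReal ((1 / 2) ^ i / 4)
        ≤ ENNReal.ofReal ((1 / 2) ^ i * (1 - (1 / 2) ^ i) ^ K.card) := by
          refine ENNReal.ofReal_le_ofReal ?_
          rw [div_eq_mul_one_div]
          gcongr
          exact quarter_le_one_sub_pow hi1 hK
      _ = ∏ z, g z := by
          rw [← Finset.mul_prod_erase _ _ (Finset.mem_univ y)]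
          have h1 : ∀ z ∈ Finset.univ.erase y, g z =
              if z ∈ insert x K then ENNReal.ofReal (1 - (1 / 2) ^ i) else 1 := fun z hz =>
            if_neg (Finset.ne_of_mem_erase hz)
          have h2 : (Finset.univ.erase y).filter (fun z => z ∈ insert x K) =
              (insert x K).erase y := by
            ext z
            simp
          rw [Finset.prod_congr rfl h1, ← Finset.prod_filter, Finset.prod_const, h2,
            Finset.card_erase_of_mem (Finset.mem_insert_of_mem hyK),
            Finset.card_insert_of_notMem hxK, Nat.add_sub_cancel,
            ENNReal.ofReal_mul (by positivity), ENNReal.ofReal_pow (sub_nonneg.2 hp1)]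
          simp only [g, if_true]
      _ ≤ _ := by
          refine Finset.prod_le_prod' fun z _ => ?_
          have hd := send_dist hclock hi z
          by_cases hzy : z = y
          · subst hzy
            simp only [g, S, if_true]
            have hpz : X.Participates h z := (mem_participants.1 hyK).2
            rcases hd with hd | hd
            · rw [hd.2.1]
            · exact absurd hpz hd.1
          · simp only [g, S, if_neg hzy]
            by_cases hzx : z = x ∨ X.G'.Adj x z
            · rw [if_pos hzx]
              rcases hd with hd | hd
              · have hzK : z ∈ insert x K := by
                  rcases hzx with rfl | hzx
                  · exact Finset.mem_insert_self _ _
                  · exact Finset.mem_insert_of_mem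
                      (mem_participants.2 ⟨hzx, hd.1⟩)
                rw [if_pos hzK, hd.2.2]
              · rw [hd.2]
                split_ifs
                · rw [← ENNReal.ofReal_one]
                  refine ENNReal.ofReal_le_ofReal ?_
                  have : (0 : ℝ) ≤ (1 / 2) ^ i := by positivity
                  linarith
                · exact le_rfl
            · rw [if_neg hzx, if_neg]
              · exact ((PMF.toOuterMeasure_apply_eq_one_iff _ _).2 (Set.subset_univ _)).ge
              · intro h1
                rcases Finset.mem_insert.1 h1 with h2 | h2
                · exact hzx (Or.inl h2)
                · exact hzx (Or.inr (mem_participants.1 h2).1)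

end Setting

/-! ## The schedules of SAP and SPP -/

theorem one_le_lg (k : ℕ) : 1 ≤ lg k := le_max_left _ _

theorem le_two_pow_lg (k : ℕ) : k ≤ 2 ^ lg k :=
  (Nat.le_pow_clog one_lt_two k).trans (Nat.pow_le_pow_right two_pos (le_max_right _ _))

theorem two_pow_lg_le {k : ℕ} (hk : 1 ≤ k) : 2 ^ lg k ≤ 2 * k := by
  rcases le_total (Nat.clog 2 k) 1 with h | h
  · rw [lg, max_eq_left h]
    omega
  · rw [lg, max_eq_right h]
    have h1 : 1 < k := by
      by_contra h2
      have := Nat.clog_of_right_le_one (by omega : k ≤ 1) 2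
      omega
    have h3 := Nat.pow_pred_clog_lt_self one_lt_two h1
    have h4 : 2 ^ Nat.clog 2 k = 2 * 2 ^ (Nat.clog 2 k).pred := by
      rw [← pow_succ', Nat.pred_eq_sub_one, Nat.sub_add_cancel h]
    omega

theorem lg_mono {k l : ℕ} (h : k ≤ l) : lg k ≤ lg l :=
  max_le_max_left _ (Nat.clog_mono_right 2 h)

theorem length_flatMap_range_le {α : Type w} (f : ℕ → List α) {i n : ℕ} (hi : i < n) :
    ((List.range i).flatMap f).length + (f i).length ≤ ((List.range n).flatMap f).length := by
  induction n with
  | zero => omega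
  | succ n ih =>
    rw [List.range_succ, List.flatMap_append, List.length_append]
    rcases Nat.lt_succ_iff_lt_or_eq.1 hi with h | rfl
    · have := ih h
      omega
    · simp

theorem getD_flatMap_range {α : Type w} (f : ℕ → List α) {i n r : ℕ} (hi : i < n)
    (hr : r < (f i).length) (d : α) :
    ((List.range n).flatMap f).getD (((List.range i).flatMap f).length + r) d = (f i).getD r d := by
  induction n with
  | zero => omega
  | succ n ih =>
    rw [List.range_succ, List.flatMap_append]
    rcases Nat.lt_succ_iff_lt_or_eq.1 hi with h | rfl
    · have := length_flatMap_range_le f h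
      rw [List.getD_append _ _ _ _ (by omega)]
      exact ih h
    · rw [List.getD_append_right _ _ _ _ (by omega)]
      simp

/-- A geometric series, written without subtraction. -/
theorem length_sapEpoch_add (a N D : ℕ) :
    (sapEpoch a N D).length + 2 * (a * lg N) = a * lg N * 2 ^ (lg D + 1) := by
  have h : ∀ n : ℕ, ((List.range n).flatMap fun i =>
      List.replicate (a * 2 ^ (i + 1) * lg N) (i + 1)).length + 2 * (a * lg N) =
        a * lg N * 2 ^ (n + 1) := by
    intro n
    induction n with
    | zero => simp; ring
    | succ n ih =>
      rw [List.range_succ, List.flatMap_append, List.length_append, add_right_comm, ih]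
      simp
      ring
  exact h (lg D)

theorem length_sppEpoch (D : ℕ) : (sppEpoch D).length = lg D := by simp [sppEpoch]

theorem two_mul_lg_le_two_pow (D : ℕ) : 2 * lg D + 2 ≤ 2 ^ (lg D + 1) := by
  have := Nat.lt_two_pow_self (n := lg D)
  rw [pow_succ]
  omega

theorem le_length_sapEpoch (a N D : ℕ) : 2 * (a * lg N) * lg D ≤ (sapEpoch a N D).length := by
  have h1 := length_sapEpoch_add a N D
  have h2 := Nat.mul_le_mul_left (a * lg N) (two_mul_lg_le_two_pow D)
  have h3 : a * lg N * (2 * lg D + 2) = 2 * (a * lg N) * lg D + 2 * (a * lg N) := by ring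
  omega

theorem length_sapEpoch_pos {a : ℕ} (ha : 1 ≤ a) (N D : ℕ) : 0 < (sapEpoch a N D).length :=
  lt_of_lt_of_le (Nat.mul_pos (Nat.mul_pos two_pos (Nat.mul_pos ha (one_le_lg N))) (one_le_lg D))
    (le_length_sapEpoch a N D)

theorem length_sapEpoch_le (a N : ℕ) {D : ℕ} (hD : 1 ≤ D) :
    (sapEpoch a N D).length ≤ 4 * (a * D * lg N) := by
  have h1 := length_sapEpoch_add a N D
  have h2 := Nat.mul_le_mul_left (a * lg N) (Nat.mul_le_mul_right 2 (two_pow_lg_le hD))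
  rw [← pow_succ] at h2
  have h3 : a * lg N * (2 * D * 2) = 4 * (a * D * lg N) := by ring
  omega

/-- The number of rounds of an epoch of SAP before phase `i + 1`. -/
def sapOffset (a N i : ℕ) : ℕ :=
  ((List.range i).flatMap fun i => List.replicate (a * 2 ^ (i + 1) * lg N) (i + 1)).length

theorem sapOffset_add_le (a N : ℕ) {D i : ℕ} (hi : i < lg D) :
    sapOffset a N i + a * 2 ^ (i + 1) * lg N ≤ (sapEpoch a N D).length := by
  have := length_flatMap_range_le (fun i => List.replicate (a * 2 ^ (i + 1) * lg N) (i + 1)) hi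
  rwa [List.length_replicate] at this

theorem getD_sapEpoch (a N : ℕ) {D i r : ℕ} (hi : i < lg D) (hr : r < a * 2 ^ (i + 1) * lg N) :
    (sapEpoch a N D).getD (sapOffset a N i + r) 0 = i + 1 := by
  refine (getD_flatMap_range (fun i => List.replicate (a * 2 ^ (i + 1) * lg N) (i + 1)) hi
    (by simpa using hr) 0).trans ?_
  simp [hr]

theorem getD_sppEpoch {D i : ℕ} (hi : i < lg D) : (sppEpoch D).getD i 0 = i + 1 := by
  simp [sppEpoch, hi]

/-- The level of all transmissions in the round with index `t`. -/
def commonLevel (a N D t : ℕ) : ℕ :=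
  if Even t then (sapEpoch a N D).getD (t / 2 % (sapEpoch a N D).length) 0
  else (sppEpoch D).getD (t / 2 % (sppEpoch D).length) 0

theorem eq_commonLevel {a b N D t₀ t j : ℕ}
    (h : interleaveLevel (SAP a N D) (SPP b N D) t₀ t = some j) : j = commonLevel a N D t := by
  unfold interleaveLevel at h
  unfold commonLevel
  split_ifs at h ⊢
  · simp only [SAP] at h
    split_ifs at h
    exact (Option.some.inj h).symm
  · simp only [SPP] at h
    split_ifs at h
    exact (Option.some.inj h).symm

/-- Only messages input before round `cutoff a N D t` may be sent in round `t`. -/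
def cutoff (a N D t : ℕ) : ℕ :=
  if Even t then 2 * ((sapEpoch a N D).length * (t / 2 / (sapEpoch a N D).length))
  else 2 * ((sppEpoch D).length * (t / 2 / (sppEpoch D).length)) + 1

theorem cutoff_le (a N D t : ℕ) : cutoff a N D t ≤ t := by
  unfold cutoff
  split_ifs with h
  · have := Nat.mul_div_le (t / 2) (sapEpoch a N D).length
    omega
  · have := Nat.mul_div_le (t / 2) (sppEpoch D).length
    rw [Nat.not_even_iff_odd] at h
    obtain ⟨j, rfl⟩ := h
    omega

theorem lt_cutoff_of_isSome {a b N D t₀ t : ℕ}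
    (h : (interleaveLevel (SAP a N D) (SPP b N D) t₀ t).isSome) : t₀ < cutoff a N D t := by
  unfold interleaveLevel at h
  unfold cutoff
  split_ifs at h ⊢
  · simp only [SAP] at h
    split_ifs at h with h1
    · omega
    · simp at h
  · simp only [SPP] at h
    split_ifs at h with h1
    · omega
    · simp at h

theorem isSome_of_lt_cutoff {a b N D t₀ t : ℕ} (hb : 8 * a < b) (hD : 1 ≤ D)
    (h : t₀ < cutoff a N D t) (ht : t ≤ t₀ + 4 * (sapEpoch a N D).length) :
    (interleaveLevel (SAP a N D) (SPP b N D) t₀ t).isSome := by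
  unfold cutoff at h
  unfold interleaveLevel
  split_ifs at h ⊢
  · simp only [SAP]
    rw [if_pos (by omega)]
    rfl
  · simp only [SPP]
    -- Half of the at most `4 L` rounds since the input, with `L` the length of a SAP epoch, belong
    -- to SPP: at most `8 a D lg N`. The `b D lg N` epochs of SPP last at least one SPP round each.
    have h1 := length_sapEpoch_le a N hD
    have h2 : 8 * a * (D * lg N) < b * (D * lg N) :=
      Nat.mul_lt_mul_of_pos_right hb (Nat.mul_pos hD (one_le_lg N))
    have h3 : 1 * (b * D * lg N) ≤ (sppEpoch D).length * (b * D * lg N) :=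
      Nat.mul_le_mul_right _ (by rw [length_sppEpoch]; exact one_le_lg D)
    have h4 : 8 * a * (D * lg N) = 2 * (4 * (a * D * lg N)) := by ring
    have h5 : b * (D * lg N) = 1 * (b * D * lg N) := by ring
    have h6 := Nat.mul_div_le (t / 2) (sppEpoch D).length
    rw [if_pos ⟨by omega, by omega⟩]
    rfl

/-- Within two epochs, SAP acknowledges a message. -/
theorem exists_acks {a : ℕ} (ha : 1 ≤ a) (N D t₀ : ℕ) : ∃ s, t₀ ≤ s ∧
    s + 2 ≤ t₀ + 4 * (sapEpoch a N D).length ∧ Even s ∧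
      (SAP a N D).acks (t₀ / 2 + 1) (s / 2) := by
  have hL := length_sapEpoch_pos ha N D
  simp only [SAP]
  set L := (sapEpoch a N D).length
  -- The first epoch that begins after the input; its last round will be the witness.
  set e := t₀ / 2 / L + 1 with he
  have h1 := Nat.mul_div_le (t₀ / 2) L
  have h2 : t₀ / 2 < L * e := Nat.lt_mul_div_succ _ hL
  have h3 : L * e = L * (t₀ / 2 / L) + L := by rw [he]; ring
  have h4 : (2 * (L * e + L - 1)) / 2 = L * e + L - 1 := by omega
  have h5 : (L * e + L - 1) / L = e := by
    rw [show L * e + L - 1 = (L - 1) + L * e by omega, Nat.add_mul_div_left _ _ hL,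
      Nat.div_eq_of_lt (by omega), zero_add]
  refine ⟨2 * (L * e + L - 1), by omega, by omega, even_two_mul _, ?_⟩
  rw [h4, h5]
  refine ⟨by omega, ?_⟩
  have h6 : L * (e + 1) = L * e + L := by ring
  rw [show L * e + L - 1 + 1 = L * (e + 1) by omega]
  exact dvd_mul_right _ _

/-- The settings for SAP interleaved with SPP. -/
abbrev SapSppSetting (a b N D : ℕ) (V : Type v) [Fintype V] (M : Type u) :=
  Setting fun _ : Fin (Fintype.card V) => interleave (SAP a N D) (SPP b N D) M

namespace Setting

variable {V : Type v} [Fintype V] {M : Type u} {a b N D : ℕ} {X : SapSppSetting a b N D V M}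

theorem le_of_current (ha : 1 ≤ a) (hwf : X.WellFormed) {h : X.History} (hr : X.Reachable h) {t : ℕ}
    (ht : t < h.length) {x : V} {m : M} {t₀ : ℕ}
    (hc : X.current (h.take t) x = some (m, t₀)) :
    t ≤ t₀ + 4 * (sapEpoch a N D).length := by
  obtain ⟨s, h1, h2, h3, h4⟩ := exists_acks ha N D t₀
  have h5 := (current_take hwf hr ht hc).2.2.2 s h1
  by_contra h6
  exact h5 (by omega) h3 h4

/-! ## Local broadcast -/

/-- Acknowledgments are synchronous: whatever the message, they fall on the ends of SAP epochs. -/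
theorem even_and_dvd_of_ackAt (hwf : X.WellFormed) {h : X.History} (hr : X.Reachable h) {s : ℕ}
    {x : V} {m : M} (ha : X.AckAt h s x m) :
    Even s ∧ (sapEpoch a N D).length ∣ s / 2 + 1 := by
  obtain ⟨t₀, -, h1, h2⟩ := current_of_ackAt hwf hr ha
  exact ⟨h1, h2.2⟩

theorem ackAt_le (ha : 1 ≤ a) (hwf : X.WellFormed) {h : X.History} (hr : X.Reachable h) {r s : ℕ}
    {x : V} {m : M} (hb : X.BcastAt h r x m) (hs : X.AckAt h s x m) :
    s ≤ r + 4 * (sapEpoch a N D).length := by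
  obtain ⟨t₀, h1, -, -⟩ := current_of_ackAt hwf hr hs
  obtain ⟨-, h2, -⟩ := current_take hwf hr hs.lt h1
  obtain rfl := ((hwf _ hr).1 t₀ r x x m h2 hb).1
  exact le_of_current ha hwf hr hs.lt h1

theorem getElem?_map_range {α : Type w} {e : ℕ → α} {T t : ℕ} {r : α} :
    ((List.range T).map e)[t]? = some r ↔ t < T ∧ e t = r := by
  rw [List.getElem?_map, Option.map_eq_some_iff]
  constructor
  · rintro ⟨i, h1, h2⟩
    obtain ⟨h3, h4⟩ := List.getElem?_eq_some_iff.1 h1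
    rw [List.getElem_range] at h4
    rw [List.length_range] at h3
    subst h4
    exact ⟨h3, h2⟩
  · rintro ⟨h1, h2⟩
    exact ⟨t, by simp [h1], h2⟩

theorem bcastAt_map_range {e : ℕ → Round X.P} {T t : ℕ} {x : V} {m : M} :
    X.BcastAt ((List.range T).map e) t x m ↔ t < T ∧ (e t).bcast x = some m := by
  simp only [BcastAt, getElem?_map_range]
  exact ⟨fun ⟨_, ⟨h1, h2⟩, h3⟩ => ⟨h1, h2 ▸ h3⟩, fun h => ⟨_, ⟨h.1, rfl⟩, h.2⟩⟩

theorem ackAt_map_range {e : ℕ → Round X.P} {T t : ℕ} {x : V} {m : M} :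
    X.AckAt ((List.range T).map e) t x m ↔ t < T ∧ (e t).ack x = some m := by
  simp only [AckAt, getElem?_map_range]
  exact ⟨fun ⟨_, ⟨h1, h2⟩, h3⟩ => ⟨h1, h2 ▸ h3⟩, fun h => ⟨_, ⟨h.1, rfl⟩, h.2⟩⟩

theorem rcvAt_map_range {e : ℕ → Round X.P} {T t : ℕ} {x : V} {m : M} :
    X.RcvAt ((List.range T).map e) t x m ↔ t < T ∧ (e t).rcv x = some m := by
  simp only [RcvAt, getElem?_map_range]
  exact ⟨fun ⟨_, ⟨h1, h2⟩, h3⟩ => ⟨h1, h2 ▸ h3⟩, fun h => ⟨_, ⟨h.1, rfl⟩, h.2⟩⟩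

theorem exists_ackAt (ha : 1 ≤ a) (hwf : X.WellFormed) {h : X.History} (hr : X.Reachable h) {t : ℕ}
    {x : V} {m : M} (hb : X.BcastAt h t x m)
    (hlen : t + 4 * (sapEpoch a N D).length ≤ h.length) : ∃ s ≥ t, X.AckAt h s x m := by
  obtain ⟨s, h1, h2, h3, h4⟩ := exists_acks ha N D t
  have hi := invariant_of_reachable hwf hr x
  rcases hi.pending_or_ack m t hb with h5 | h5
  · exact absurd h4 (hi.not_acks_of_pending m t h5 s h1 (by omega) h3)
  · exact h5

theorem ack_of_bcast_of_isExecution (ha : 1 ≤ a) (hwf : X.WellFormed) {e : ℕ → Round X.P}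
    (he : X.IsExecution e) {t : ℕ} {x : V} {m : M} (hb : (e t).bcast x = some m) :
    ∃ t' ≥ t, (e t').ack x = some m ∧ ∀ s, (e s).ack x = some m → s = t' := by
  obtain ⟨s, h1, h2⟩ := exists_ackAt ha hwf (he (t + 4 * (sapEpoch a N D).length + 1))
    (bcastAt_map_range.2 ⟨by omega, hb⟩) (by simp)
  refine ⟨s, h1, (ackAt_map_range.1 h2).2, fun s' hs' => ?_⟩
  exact (invariant_of_reachable hwf (he (s + s' + 1)) x).ack_unique m s' s
    (ackAt_map_range.2 ⟨by omega, hs'⟩) (ackAt_map_range.2 ⟨by omega, (ackAt_map_range.1 h2).2⟩)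

theorem bcast_of_ack_of_isExecution (hwf : X.WellFormed) {e : ℕ → Round X.P}
    (he : X.IsExecution e) {t' : ℕ} {x : V} {m : M} (ha : (e t').ack x = some m) :
    ∃ t ≤ t', (e t).bcast x = some m := by
  obtain ⟨t, h1, h2⟩ := (invariant_of_reachable hwf (he (t' + 1)) x).bcast_of_ack m t'
    (ackAt_map_range.2 ⟨by omega, ha⟩)
  exact ⟨t, h1, (bcastAt_map_range.1 h2).2⟩

theorem rcv_unique_of_isExecution (hwf : X.WellFormed) {e : ℕ → Round X.P}
    (he : X.IsExecution e) {s t : ℕ} {x : V} {m : M} (hs : (e s).rcv x = some m)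
    (ht : (e t).rcv x = some m) : s = t :=
  (invariant_of_reachable hwf (he (s + t + 1)) x).rcv_unique m s t
    (rcvAt_map_range.2 ⟨by omega, hs⟩) (rcvAt_map_range.2 ⟨by omega, ht⟩)

theorem rcv_valid_of_isExecution (hwf : X.WellFormed) {e : ℕ → Round X.P}
    (he : X.IsExecution e) {t : ℕ} {x : V} {m : M} (ht : (e t).rcv x = some m) :
    ∃ y, X.G'.Adj x y ∧ (∃ s < t, (e s).bcast y = some m) ∧ ∀ s < t, (e s).ack y ≠ some m := by
  have hr := he (t + 1)
  have hρ : ((List.range (t + 1)).map e)[t]? = some (e t) := getElem?_map_range.2 ⟨by omega, rfl⟩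
  obtain ⟨y, h1, h2⟩ := exists_sender_of_rcvAt hr hρ ht
  obtain ⟨⟨-, h3⟩, t₀, h4, h5⟩ := activeWith_of_sent hwf hr hρ h2
  have h6 := lt_cutoff_of_isSome h5
  have h7 := cutoff_le a N D t
  have h8 := (bcastAt_map_range.1 (current_take hwf hr (by simp) h4).2.1).2
  exact ⟨y, h1, ⟨t₀, by omega, h8⟩, fun s hs hack => h3 s hs (ackAt_map_range.2 ⟨by omega, hack⟩)⟩

/-! ## Hits -/

/-- A lower bound on the probability that `x` hears a message from a neighbour in `T`. -/
def hitRate (X : SapSppSetting a b N D V M) (T : Set V) (x : V) (h : X.History) : ℝ :=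
  if 1 ≤ commonLevel a N D h.length ∧ (X.participants h x).card ≤ 2 ^ commonLevel a N D h.length
  then (X.targets T h x).card * (1 / 2) ^ commonLevel a N D h.length / 4 else 0

theorem hitRate_nonneg (T : Set V) (x : V) (h : X.History) : 0 ≤ X.hitRate T x h := by
  unfold hitRate
  split_ifs <;> positivity

theorem hitRate_le_prob (hwf : X.WellFormed) (T : Set V) (x : V) (h : X.History)
    (hr : X.Reachable h) :
    ENNReal.ofReal (X.hitRate T x h) ≤ (X.roundDist h).toOuterMeasure {ρ | X.Hit T x ρ} := by
  unfold hitRate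
  split_ifs with h1
  · exact le_prob_hit (fun x => (invariant_of_reachable hwf hr x).clock)
      (fun _ _ => eq_commonLevel) h1.1 T x h1.2
  · simp

theorem exists_rcvAt_of_hit (hwf : X.WellFormed) {h : X.History} (hr : X.Reachable h) {t : ℕ}
    {ρ : Round X.P} (hρ : h[t]? = some ρ) {T : Set V} {x : V} (hh : X.Hit T x ρ) :
    ∃ y ∈ T, ∃ m, X.G.Adj x y ∧ X.ActiveWith h t y m ∧ ∃ s ≤ t, X.RcvAt h s x m := by
  obtain ⟨y, h1, h2, h3, h4⟩ := hh
  obtain ⟨m, hm⟩ := Option.isSome_iff_exists.1 h3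
  exact ⟨y, h1, m, h2, (activeWith_of_sent hwf hr hρ hm).1,
    exists_rcvAt_of_heard hwf hr hρ h2.ne hm (h4.trans hm)⟩

/-- A sender's input came before the cutoff of the current epoch, so the contention in one fixed
round bounds the number of participants throughout the epoch. -/
theorem active_of_participates (hwf : X.WellFormed) {h : X.History} (hr : X.Reachable h) {t : ℕ}
    (ht : t < h.length) {z : V} (hz : X.Participates (h.take t) z) :
    X.Active h (cutoff a N D t - 1) z := by
  obtain ⟨m, t₀, h1, h2⟩ := hz
  rw [List.length_take, min_eq_left ht.le] at h2
  have h3 := lt_cutoff_of_isSome h2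
  have h4 := cutoff_le a N D t
  have h5 := ((activeWith_iff_current hwf hr ht).2 ⟨t₀, h1⟩).2
  exact ⟨m, ⟨t₀, by omega, (current_take hwf hr ht h1).2.1⟩, fun s hs => h5 s (by omega)⟩

/-- If no SAP epoch ends from round `s` until before round `t`, nobody can have acknowledged in the
meantime, and SPP has not run out because `8 * a < b`. -/
theorem participates_of_active (ha : 1 ≤ a) (hb : 8 * a < b) (hD : 1 ≤ D) (hwf : X.WellFormed)
    {h : X.History} (hr : X.Reachable h) {s t : ℕ} (ht : t < h.length) {z : V}
    (hz : X.Active h s z) (hs : s < cutoff a N D t)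
    (hq : ∀ q, s ≤ q → q < t → Even q → ¬ (sapEpoch a N D).length ∣ q / 2 + 1) :
    X.Participates (h.take t) z := by
  obtain ⟨m, ⟨t₀, h1, h2⟩, h3⟩ := hz
  have h4 : X.ActiveWith h t z m := by
    have := cutoff_le a N D t
    refine ⟨⟨t₀, by omega, h2⟩, fun q hqt hack => ?_⟩
    by_cases hqs : q < s
    · exact h3 q hqs hack
    · obtain ⟨h5, h6⟩ := even_and_dvd_of_ackAt hwf hr hack
      exact hq q (by omega) hqt h5 h6
  obtain ⟨t₁, h5⟩ := (activeWith_iff_current hwf hr ht).1 h4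
  obtain ⟨h6, h7, -⟩ := current_take hwf hr ht h5
  obtain rfl := ((hwf _ hr).1 t₁ t₀ z z m h7 h2).1
  refine ⟨m, t₁, h5, ?_⟩
  rw [List.length_take, min_eq_left ht.le]
  exact isSome_of_lt_cutoff hb hD (by omega) (le_of_current ha hwf hr ht h5)

theorem card_participants_le (hwf : X.WellFormed) {h : X.History} (hr : X.Reachable h) {t : ℕ}
    (ht : t < h.length) (x : V) :
    (X.participants (h.take t) x).card ≤ X.contention h x (cutoff a N D t - 1) := by
  refine Finset.card_le_card fun z hz => ?_
  rw [mem_participants] at hz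
  simp [hz.1, active_of_participates hwf hr ht hz.2]

theorem one_le_contention {h : X.History} {x y : V} {t : ℕ} (hxy : X.G'.Adj x y)
    (hy : X.Active h t y) : 1 ≤ X.contention h x t :=
  Finset.card_pos.2 ⟨y, by simp [hxy, hy]⟩

/-- In the phase of an epoch of SAP that fits the contention, the probabilities of a hit sum up
to a multiple of `lg N`. -/
theorem le_sum_hitRate_sap (ha : 1 ≤ a) (hb : 8 * a < b) (hD : 1 ≤ D) (hwf : X.WellFormed)
    {h : X.History} (hr : X.Reachable h) {T : Set V} {x y : V} (hy : y ∈ T) (hxy : X.G.Adj x y)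
    {L e : ℕ} (hLdef : L = (sapEpoch a N D).length) (he : 1 ≤ e)
    (hlen : 2 * (L * (e + 1)) ≤ h.length + 1)
    (hact : X.Active h (2 * (L * e) - 1) y)
    (hcont : X.contention h x (2 * (L * e) - 1) ≤ D)
    (I : Finset ℕ) (hI : ∀ t, 2 * (L * e) ≤ t →
      t + 1 < 2 * (L * (e + 1)) → t ∈ I) :
    (a * lg N / 4 : ℝ) ≤ ∑ t ∈ I, X.hitRate T x (h.take t) := by
  have hL := length_sapEpoch_pos ha N D
  rw [← hLdef] at hL
  have hLe : 1 ≤ L * e := Nat.mul_pos hL he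
  have hLe1 : L * (e + 1) = L * e + L := by ring
  set k := X.contention h x (2 * (L * e) - 1) with hk
  -- The fitting phase is `i + 1 = lg k`, where `k` is the contention in the last round before the
  -- epoch. That round comes after the acknowledgments of the preceding epoch, which are output one
  -- round earlier.
  obtain ⟨i, hi⟩ : ∃ i, lg k = i + 1 := ⟨lg k - 1, by have := one_le_lg k; omega⟩
  have hiD : i < lg D := by have := lg_mono hcont; omega
  set n := a * 2 ^ (i + 1) * lg N with hn
  have hoff : sapOffset a N i + n ≤ L := hLdef ▸ sapOffset_add_le a N hiD
  have key : ∀ r ∈ Finset.range n, (1 / 2 : ℝ) ^ (i + 1) / 4 ≤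
      X.hitRate T x (h.take (2 * (L * e + (sapOffset a N i + r)))) := by
    intro r hrn
    rw [Finset.mem_range] at hrn
    set t := 2 * (L * e + (sapOffset a N i + r)) with ht
    have ht2 : t / 2 = L * e + (sapOffset a N i + r) := by omega
    have htlt : t < h.length := by omega
    have hdiv : t / 2 / L = e := by
      rw [ht2, Nat.mul_add_div hL, Nat.div_eq_of_lt (by omega), add_zero]
    have hmod : t / 2 % L = sapOffset a N i + r := by
      rw [ht2, Nat.mul_add_mod, Nat.mod_eq_of_lt (by omega)]
    have hcut : cutoff a N D t = 2 * (L * e) := by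
      rw [cutoff, if_pos (even_two_mul _), ← hLdef, hdiv]
    have hlev : commonLevel a N D (h.take t).length = i + 1 := by
      rw [List.length_take, min_eq_left htlt.le, commonLevel, if_pos (even_two_mul _), ← hLdef,
        hmod, getD_sapEpoch a N hiD hrn]
    have hK : (X.participants (h.take t) x).card ≤ 2 ^ (i + 1) := by
      have h1 := card_participants_le hwf hr htlt x
      rw [hcut, ← hk] at h1
      rw [← hi]
      exact h1.trans (le_two_pow_lg k)
    have hY : y ∈ X.targets T (h.take t) x := by
      refine mem_targets.2 ⟨hy, hxy, ?_⟩
      refine participates_of_active ha hb hD hwf hr htlt hact (by omega) ?_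
      -- Such an acknowledgment would put a multiple of `L` strictly between `L * e` and `L * (e +
      -- 1)`.
      rintro q hq1 hq2 ⟨q', rfl⟩ ⟨c, hc⟩
      rw [← hLdef] at hc
      have h1 : L * e < L * c := by omega
      have h2 : L * c < L * (e + 1) := by omega
      have h3 := Nat.lt_of_mul_lt_mul_left h1
      have h4 := Nat.lt_of_mul_lt_mul_left h2
      omega
    rw [hitRate, hlev, if_pos ⟨by omega, hK⟩]
    have h1 : (1 : ℝ) ≤ (X.targets T (h.take t) x).card := by
      exact_mod_cast Finset.card_pos.2 ⟨y, hY⟩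
    have h2 : (0 : ℝ) < (1 / 2) ^ (i + 1) := by positivity
    nlinarith
  -- The factor `2 ^ (i + 1)` in the length of the phase cancels the sending probability.
  calc (a * lg N / 4 : ℝ) = ∑ r ∈ Finset.range n, (1 / 2 : ℝ) ^ (i + 1) / 4 := by
        rw [Finset.sum_const, Finset.card_range, nsmul_eq_mul, hn]
        push_cast
        rw [one_div, inv_pow]
        field_simp
    _ ≤ ∑ r ∈ Finset.range n, X.hitRate T x (h.take (2 * (L * e + (sapOffset a N i + r)))) :=
        Finset.sum_le_sum key
    _ = ∑ t ∈ (Finset.range n).image fun r => 2 * (L * e + (sapOffset a N i + r)),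
          X.hitRate T x (h.take t) := by
        rw [Finset.sum_image]
        intro r _ r' _ hrr
        simp only at hrr
        omega
    _ ≤ _ := by
        refine Finset.sum_le_sum_of_subset_of_nonneg ?_ fun t _ _ => hitRate_nonneg T x _
        intro t ht
        obtain ⟨r, hr1, rfl⟩ := Finset.mem_image.1 ht
        rw [Finset.mem_range] at hr1
        exact hI _ (by omega) (by omega)

/-- An epoch of SPP during which no message is acknowledged has a round in which a hit is
sufficiently likely. -/
theorem exists_le_hitRate_spp (ha : 1 ≤ a) (hb : 8 * a < b) (hD : 1 ≤ D) (hwf : X.WellFormed)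
    {h : X.History} (hr : X.Reachable h) {x y : V} (hxy : X.G.Adj x y) {f : ℕ}
    (hlen : 2 * (lg D * (f + 1)) ≤ h.length) (hact : X.Active h (2 * (lg D * f)) y)
    (hcont : X.contention h x (2 * (lg D * f)) ≤ D)
    (hq : ∀ q, 2 * (lg D * f) ≤ q → q + 1 < 2 * (lg D * (f + 1)) → Even q →
      ¬ (sapEpoch a N D).length ∣ q / 2 + 1) :
    ∃ t, 2 * (lg D * f) ≤ t ∧ t < 2 * (lg D * (f + 1)) ∧
      1 / (8 * X.contention h x (2 * (lg D * f)) : ℝ) ≤ X.hitRate Set.univ x (h.take t) ∧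
      (X.G = X.G' → 1 / 8 ≤ X.hitRate Set.univ x (h.take t)) := by
  have hl := one_le_lg D
  have hk1 := one_le_contention (X.le hxy) hact
  set l := lg D with hldef
  set k := X.contention h x (2 * (l * f)) with hk
  obtain ⟨i, hi⟩ : ∃ i, lg k = i + 1 := ⟨lg k - 1, by have := one_le_lg k; omega⟩
  have hiD : i < l := by have := lg_mono hcont; omega
  have hlf : l * (f + 1) = l * f + l := by ring
  set t := 2 * (l * f + i) + 1 with ht
  have ht2 : t / 2 = l * f + i := by omega
  have htlt : t < h.length := by omega
  have hodd : ¬ Even t := Nat.not_even_bit1 _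
  have hdiv : t / 2 / l = f := by
    rw [ht2, Nat.mul_add_div (by omega), Nat.div_eq_of_lt (by omega), add_zero]
  have hmod : t / 2 % l = i := by
    rw [ht2, Nat.mul_add_mod, Nat.mod_eq_of_lt (by omega)]
  have hcut : cutoff a N D t = 2 * (l * f) + 1 := by
    rw [cutoff, if_neg hodd, length_sppEpoch, ← hldef, hdiv]
  have hlev : commonLevel a N D (h.take t).length = i + 1 := by
    rw [List.length_take, min_eq_left htlt.le, commonLevel, if_neg hodd, length_sppEpoch, ← hldef,
      hmod, getD_sppEpoch hiD]
  have hpart : ∀ z, X.Active h (2 * (l * f)) z → X.Participates (h.take t) z := fun z hz =>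
    participates_of_active ha hb hD hwf hr htlt hz (by omega) fun q h1 h2 => hq q h1 (by omega)
  have hK : (X.participants (h.take t) x).card ≤ 2 ^ (i + 1) := by
    have h1 := card_participants_le hwf hr htlt x
    rw [hcut, Nat.add_sub_cancel, ← hk] at h1
    rw [← hi]
    exact h1.trans (le_two_pow_lg k)
  have hrate : X.hitRate Set.univ x (h.take t) =
      (X.targets Set.univ (h.take t) x).card * (1 / 2) ^ (i + 1) / 4 := by
    rw [hitRate, hlev, if_pos ⟨by omega, hK⟩]
  have hpow : 1 / (2 * k : ℝ) ≤ (1 / 2) ^ (i + 1) := by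
    rw [one_div, one_div, inv_pow]
    refine inv_anti₀ (by positivity) ?_
    rw [← hi]
    exact_mod_cast two_pow_lg_le hk1
  have hk0 : (0 : ℝ) < k := by exact_mod_cast hk1
  refine ⟨t, by omega, by omega, ?_, fun hG => ?_⟩
  · have h1 : (1 : ℝ) ≤ (X.targets Set.univ (h.take t) x).card := by
      exact_mod_cast Finset.card_pos.2
        ⟨y, mem_targets.2 ⟨Set.mem_univ _, hxy, hpart y hact⟩⟩
    rw [hrate]
    calc 1 / (8 * k : ℝ) = 1 * (1 / (2 * k)) / 4 := by field_simp; norm_num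
      _ ≤ _ := by gcongr
  -- If `G = G'`, no active neighbour merely interferes: each of the `k` is a target, so the factor
  -- `1 / k` disappears.
  · have h1 : k ≤ (X.targets Set.univ (h.take t) x).card := by
      refine Finset.card_le_card fun z hz => ?_
      simp only [Finset.mem_filter] at hz
      exact mem_targets.2 ⟨Set.mem_univ _, hG ▸ hz.2.1, hpart z hz.2.2⟩
    have h2 : (k : ℝ) ≤ (X.targets Set.univ (h.take t) x).card := by exact_mod_cast h1
    rw [hrate]
    calc (1 / 8 : ℝ) = k * (1 / (2 * k)) / 4 := by field_simp; norm_num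
      _ ≤ _ := by gcongr

/-- In an interval of rounds during which no message is acknowledged, each epoch of SPP
contributes to the sum of the probabilities of a hit. -/
theorem le_sum_hitRate_spp (ha : 1 ≤ a) (hb : 8 * a < b) (hD : 1 ≤ D) (hwf : X.WellFormed)
    {h : X.History} (hr : X.Reachable h) {x y : V} (hxy : X.G.Adj x y) {t₁ t₂ : ℕ}
    (hlen : t₂ < h.length) (hact : ∀ t, t₁ ≤ t → t ≤ t₂ → X.Active h t y)
    (hcont : ∀ t, t₁ ≤ t → t ≤ t₂ → X.contention h x t ≤ D)
    (hq : ∀ q, t₁ ≤ q → q < t₂ → Even q → ¬ (sapEpoch a N D).length ∣ q / 2 + 1)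
    {g : ℝ} (hg : 0 ≤ g) (hgle : (X.G = X.G' ∧ g ≤ 1 / 8) ∨
      ∀ t, t₁ ≤ t → t ≤ t₂ → g ≤ 1 / (8 * X.contention h x t : ℝ))
    (I : Finset ℕ) (hI : ∀ t, t₁ ≤ t → t ≤ t₂ → t ∈ I) :
    (((t₂ : ℝ) + 1 - t₁) / (2 * lg D) - 2) * g ≤ ∑ t ∈ I, X.hitRate Set.univ x (h.take t) := by
  have hl := one_le_lg D
  set f₀ := t₁ / (2 * lg D) + 1 with hf₀
  -- The number of whole SPP epochs inside the interval, starting with epoch `f₀`; incomplete ones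
  -- at the two ends account for the `- 2`. Truncation of the difference at `0` only helps.
  set F := (t₂ + 1) / (2 * lg D) - f₀ with hF
  have h1 : t₁ < 2 * lg D * f₀ := Nat.lt_mul_div_succ _ (by omega)
  have h2 : 2 * lg D * f₀ ≤ t₁ + 2 * lg D := by
    have := Nat.mul_div_le t₁ (2 * lg D)
    rw [hf₀, mul_add]
    omega
  have h3 : t₂ + 1 < 2 * lg D * (f₀ + F) + 2 * lg D := by
    have h4 : t₂ + 1 < 2 * lg D * ((t₂ + 1) / (2 * lg D) + 1) := Nat.lt_mul_div_succ _ (by omega)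
    have h5 : 2 * lg D * ((t₂ + 1) / (2 * lg D)) ≤ 2 * lg D * (f₀ + F) :=
      Nat.mul_le_mul_left _ (by omega)
    rw [mul_add] at h4
    omega
  have hFle : ((t₂ : ℝ) + 1 - t₁) / (2 * lg D) - 2 ≤ F := by
    have hl0 : (0 : ℝ) < 2 * lg D := by positivity
    rw [sub_le_iff_le_add, div_le_iff₀ hl0]
    have h4 : ((t₂ : ℝ) + 1) ≤ 2 * lg D * (f₀ + F) + 2 * lg D := by exact_mod_cast h3.le
    have h5 : (2 * lg D * f₀ : ℝ) ≤ t₁ + 2 * lg D := by exact_mod_cast h2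
    nlinarith
  have key : ∀ j ∈ Finset.range F, ∃ t, 2 * (lg D * (f₀ + j)) ≤ t ∧ t < 2 * (lg D * (f₀ + j + 1)) ∧
      t ≤ t₂ ∧ g ≤ X.hitRate Set.univ x (h.take t) := by
    intro j hj
    rw [Finset.mem_range] at hj
    have h4 : 2 * (lg D * (f₀ + j + 1)) ≤ t₂ + 1 := by
      have h5 := Nat.mul_div_le (t₂ + 1) (2 * lg D)
      have h6 : 2 * lg D * (f₀ + j + 1) ≤ 2 * lg D * ((t₂ + 1) / (2 * lg D)) :=
        Nat.mul_le_mul_left _ (by omega)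
      rw [mul_assoc] at h6
      omega
    have h5 : 2 * lg D * f₀ ≤ 2 * lg D * (f₀ + j) := Nat.mul_le_mul_left _ (by omega)
    rw [mul_assoc 2 (lg D) (f₀ + j)] at h5
    have h6 : lg D * (f₀ + j + 1) = lg D * (f₀ + j) + lg D := by ring
    obtain ⟨t, ht1, ht2, ht3, ht4⟩ := exists_le_hitRate_spp ha hb hD hwf hr hxy
      (f := f₀ + j) (by omega) (hact _ (by omega) (by omega)) (hcont _ (by omega) (by omega))
      fun q hq1 hq2 => hq q (by omega) (by omega)
    refine ⟨t, ht1, ht2, by omega, ?_⟩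
    rcases hgle with ⟨hG, hg1⟩ | hg1
    · exact hg1.trans (ht4 hG)
    · exact (hg1 _ (by omega) (by omega)).trans ht3
  choose! τ hτ1 hτ2 hτ3 hτ4 using key
  calc (((t₂ : ℝ) + 1 - t₁) / (2 * lg D) - 2) * g ≤ F * g := by gcongr
    _ = ∑ j ∈ Finset.range F, g := by simp
    _ ≤ ∑ j ∈ Finset.range F, X.hitRate Set.univ x (h.take (τ j)) := Finset.sum_le_sum hτ4
    _ = ∑ t ∈ (Finset.range F).image τ, X.hitRate Set.univ x (h.take t) := by
        rw [Finset.sum_image]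
        intro j hj j' hj' hjj
        -- The chosen rounds are distinct since each determines its epoch.
        have hdiv : ∀ j ∈ Finset.range F, τ j / 2 / lg D = f₀ + j := by
          intro j hj
          have h4 := hτ1 j hj
          have h5 := hτ2 j hj
          refine Nat.div_eq_of_lt_le ?_ ?_
          · rw [mul_comm]; omega
          · rw [mul_comm]; omega
        have h4 := hdiv j hj
        have h5 := hdiv j' hj'
        rw [hjj] at h4
        omega
    _ ≤ _ := by
        refine Finset.sum_le_sum_of_subset_of_nonneg ?_ fun t _ _ => hitRate_nonneg _ x _
        intro t ht
        obtain ⟨j, hj, rfl⟩ := Finset.mem_image.1 ht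
        have h4 := hτ1 j hj
        have h5 : 2 * lg D * f₀ ≤ 2 * lg D * (f₀ + j) := Nat.mul_le_mul_left _ (by omega)
        rw [mul_assoc 2 (lg D) (f₀ + j)] at h5
        exact hI _ (by omega) (hτ3 j hj)

end Setting

/-! ### Comparison of logarithms, and intervals without acknowledgments -/

theorem log_le_lg {n N : ℕ} (hn : 1 ≤ n) (h : n ≤ N) : Real.log n ≤ lg N := by
  have hn0 : (0 : ℝ) < n := by exact_mod_cast hn
  have h1 : (n : ℝ) ≤ 2 ^ lg N := by exact_mod_cast h.trans (le_two_pow_lg N)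
  have h2 := Real.log_le_log hn0 h1
  rw [Real.log_pow] at h2
  have h3 : (0 : ℝ) ≤ lg N := Nat.cast_nonneg _
  nlinarith [Real.log_two_lt_d9]

theorem lg_mul_log_two_le {k : ℕ} (hk : 1 ≤ k) :
    lg k * Real.log 2 ≤ Real.log 2 + Real.log k := by
  have hk0 : (0 : ℝ) < k := by exact_mod_cast hk
  have h1 : (2 : ℝ) ^ lg k ≤ 2 * k := by exact_mod_cast two_pow_lg_le hk
  have h2 := Real.log_le_log (by positivity) h1
  rwa [Real.log_pow, Real.log_mul two_ne_zero hk0.ne'] at h2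

theorem half_le_log {n : ℕ} (hn : 2 ≤ n) : 1 / 2 ≤ Real.log n := by
  have h := Real.log_le_log two_pos (show (2 : ℝ) ≤ n by exact_mod_cast hn)
  linarith [Real.log_two_gt_d9]

theorem log_two_le_log {n : ℕ} (hn : 2 ≤ n) : Real.log 2 ≤ Real.log n :=
  Real.log_le_log two_pos (by exact_mod_cast hn)

theorem lg_le_of_le_pow {n N p : ℕ} (hn : 2 ≤ n) (hN : 1 ≤ N) (h : N ≤ n ^ p) :
    (lg N : ℝ) ≤ 2 * (1 + p) * Real.log n := by
  have hN0 : (0 : ℝ) < N := by exact_mod_cast hN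
  have h1 := Real.log_le_log hN0 (show (N : ℝ) ≤ (n : ℝ) ^ p by exact_mod_cast h)
  rw [Real.log_pow] at h1
  have h2 := lg_mul_log_two_le hN
  have h3 := log_two_le_log hn
  have h4 : (0 : ℝ) ≤ lg N := Nat.cast_nonneg _
  nlinarith [Real.log_two_gt_d9]

/-- The constants `log κ ≤ κ - 1` and `log 2` are absorbed into multiples of `log Δ`, which is at
least `1 / 2` because `Δ ≥ 2`. -/
theorem lg_le_of_le_mul {D κ Δ : ℕ} (hΔ : 2 ≤ Δ) (hD : 1 ≤ D) (h : D ≤ κ * Δ) :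
    (lg D : ℝ) ≤ (4 + 4 * κ) * Real.log Δ := by
  have hD0 : (0 : ℝ) < D := by exact_mod_cast hD
  have hκ : κ ≠ 0 := by rintro rfl; omega
  have hκ0 : (0 : ℝ) < κ := by exact_mod_cast Nat.pos_of_ne_zero hκ
  have hΔ0 : (0 : ℝ) < Δ := by positivity
  have h1 := Real.log_le_log hD0 (show (D : ℝ) ≤ κ * Δ by exact_mod_cast h)
  rw [Real.log_mul hκ0.ne' hΔ0.ne'] at h1
  have h2 := lg_mul_log_two_le hD
  have h3 := log_two_le_log hΔ
  have h4 := half_le_log hΔ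
  have h5 := Real.log_le_sub_one_of_pos hκ0
  have h6 : (0 : ℝ) ≤ lg D := Nat.cast_nonneg _
  nlinarith [Real.log_two_gt_d9]

/-- An interval of at most `2 * L + 1` rounds has a part of half its length in whose interior no
message is acknowledged. -/
theorem exists_quiet_interval {L d : ℕ} (r : ℕ) (hd : d ≤ 2 * L) : ∃ t₁ t₂, r ≤ t₁ ∧ t₁ ≤ t₂ ∧
    t₂ ≤ r + d ∧ d + 2 * t₁ ≤ 2 * (t₂ + 1) ∧
      ∀ q, t₁ ≤ q → q < t₂ → Even q → ¬ L ∣ q / 2 + 1 := by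
  by_cases h : ∃ q, r ≤ q ∧ q < r + d ∧ Even q ∧ L ∣ q / 2 + 1
  · obtain ⟨q, h1, h2, ⟨q', rfl⟩, c, hc⟩ := h
    -- Possible acknowledgment rounds are `2 * L` apart, so at most one lies in `[r, r + d)`. The
    -- interval is cut there and the longer part kept; an acknowledgment in its last round does no
    -- harm.
    have huniq : ∀ s, r ≤ s → s < r + d → Even s → L ∣ s / 2 + 1 → s = q' + q' := by
      rintro s h3 h4 ⟨s', rfl⟩ ⟨c', hc'⟩
      have h5 : L * c' < L * (c + 1) := by rw [mul_add]; omega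
      have h6 : L * c < L * (c' + 1) := by rw [mul_add]; omega
      have h7 := Nat.lt_of_mul_lt_mul_left h5
      have h8 := Nat.lt_of_mul_lt_mul_left h6
      obtain rfl : c = c' := by omega
      omega
    by_cases hlen : d + 2 * r ≤ 2 * (q' + q' + 1)
    · refine ⟨r, q' + q', le_rfl, h1, by omega, hlen, fun s h3 h4 h5 h6 => ?_⟩
      have := huniq s h3 (by omega) h5 h6
      omega
    · refine ⟨q' + q' + 1, r + d, by omega, by omega, le_rfl, by omega, fun s h3 h4 h5 h6 => ?_⟩
      have := huniq s (by omega) h4 h5 h6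
      omega
  · push Not at h
    exact ⟨r, r + d, le_rfl, by omega, le_rfl, by omega, h⟩

/-! ### From sums of hit probabilities to reliability, acknowledgment and progress -/

namespace Setting

variable {V : Type v} [Fintype V] {M : Type u}

section General

variable {A : Algorithm V M} {X : Setting A}

theorem contention_le {Δ : ℕ} (h : X.maxContention ≤ (Δ : ℕ∞)) {H : X.History}
    (hr : X.Reachable H) (x : V) {t : ℕ} (ht : t < H.length) : X.contention H x t ≤ Δ := by
  have h1 : (X.contention H x t : ℕ∞) ≤ X.maxContention :=
    le_iSup_of_le H (le_iSup_of_le hr (le_iSup_of_le x (le_iSup_of_le t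
      (le_iSup_of_le ht le_rfl))))
  exact_mod_cast h1.trans h

theorem whp_of_card_le_one (hn : Fintype.card V ≤ 1) (r k : ℕ) (E : X.History → Prop) :
    X.WHP r k E := by
  intro h₀ _ _
  -- This covers the empty network, as `1 / 0 = ∞` in `ℝ≥0∞`.
  have h1 : (1 : ℝ≥0∞) - 1 / (Fintype.card V : ℝ≥0∞) = 0 := by
    interval_cases h : Fintype.card V <;> simp
  rw [h1]
  exact zero_le

theorem whp_of_forall {r k : ℕ} {E : X.History → Prop}
    (hE : ∀ h, X.Reachable h → h.length = r + k → E h) : X.WHP r k E :=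
  X.whp_of_cover (fun _ _ => False) ∅ (fun _ _ _ => by simp)
    fun h h1 h2 h3 => absurd (hE h h1 h2) h3

end General

variable {a b N D : ℕ} {X : SapSppSetting a b N D V M}

/-- SAP ignores the epoch in progress at the input, so the whole next epoch passes before an
acknowledgment. -/
theorem le_ackAt (hwf : X.WellFormed) {h : X.History} (hr : X.Reachable h) {r s : ℕ}
    {x : V} {m : M} (hb : X.BcastAt h r x m) (hs : X.AckAt h s x m) :
    2 * ((sapEpoch a N D).length * (r / 2 / (sapEpoch a N D).length + 1 + 1)) ≤ s + 2 := by
  obtain ⟨t₀, h1, h2, h3⟩ := current_of_ackAt hwf hr hs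
  obtain ⟨-, h4, -⟩ := current_take hwf hr hs.lt h1
  obtain rfl := ((hwf _ hr).1 t₀ r x x m h4 hb).1
  obtain ⟨h5, c, h6⟩ := h3
  set L := (sapEpoch a N D).length
  have h7 := Nat.mul_div_le (t₀ / 2) L
  have h8 := Nat.mul_div_le (s / 2) L
  have h9 : L * (t₀ / 2 / L) < L * (s / 2 / L) := by omega
  have h10 : L * (s / 2 / L) < L * c := by omega
  have h11 := Nat.lt_of_mul_lt_mul_left h9
  have h12 := Nat.lt_of_mul_lt_mul_left h10
  have h13 : L * (t₀ / 2 / L + 1 + 1) ≤ L * c := Nat.mul_le_mul_left _ (by omega)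
  omega

/-- Someone sends `m` in round `s`, and `m` is input only once. -/
theorem bcastAt_le_rcvAt (hwf : X.WellFormed) {h : X.History} (hr : X.Reachable h) {r s : ℕ}
    {x y : V} {m : M} (hb : X.BcastAt h r x m) (hs : X.RcvAt h s y m) : r ≤ s := by
  obtain ⟨ρ, h1, h2⟩ := hs
  obtain ⟨z, -, h3⟩ := exists_sender_of_rcvAt hr h1 h2
  obtain ⟨⟨t, h4, h5⟩, -⟩ := (activeWith_of_sent hwf hr h1 h3).1
  obtain rfl := ((hwf _ hr).1 t r z x m h5 hb).1
  exact h4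

theorem activeWith_unique (hwf : X.WellFormed) {h : X.History} (hr : X.Reachable h) {t : ℕ}
    (ht : t < h.length) {x : V} {m m' : M} (h1 : X.ActiveWith h t x m)
    (h2 : X.ActiveWith h t x m') : m = m' := by
  obtain ⟨t₀, h3⟩ := (activeWith_iff_current hwf hr ht).1 h1
  obtain ⟨t₁, h4⟩ := (activeWith_iff_current hwf hr ht).1 h2
  rw [h3] at h4
  simp only [Option.some.injEq, Prod.mk.injEq] at h4
  exact h4.1

/-- The first full SAP epoch after the input suffices. Each neighbour misses the message with
probability at most `n⁻²`, and there are at most `n` neighbours. -/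
theorem reliable_of_sapSpp (ha : 8 ≤ a) (hb : 8 * a < b) (hD : 1 ≤ D)
    (hN : Fintype.card V ≤ N) (hwf : X.WellFormed)
    (hcont : ∀ h, X.Reachable h → ∀ x t, t < h.length → X.contention h x t ≤ D) (x : V)
    (r k : ℕ) : X.WHP r k fun h => ∀ m r', r ≤ r' → X.BcastAt h r x m → X.AckAt h r' x m →
      ∀ y, X.G.Adj x y → ∃ t, r ≤ t ∧ t ≤ r' ∧ X.RcvAt h t y m := by
  set n := Fintype.card V with hn
  rcases Nat.lt_or_ge n 2 with hn2 | hn2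
  · exact whp_of_card_le_one (by omega) _ _ _
  have hn0 : (0 : ℝ) < n := by positivity
  have hL := length_sapEpoch_pos (by omega : 1 ≤ a) N D
  set L := (sapEpoch a N D).length with hLdef
  set e := r / 2 / L + 1 with he
  have he1 : 1 ≤ e := Nat.le_add_left 1 _
  have hre : r / 2 < L * e := Nat.lt_mul_div_succ _ hL
  have hLe1 : L * (e + 1) = L * e + L := by ring
  let I := Finset.Ico r (2 * (L * (e + 1)) - 1)
  have hI : ∀ t, t ∈ I ↔ r ≤ t ∧ t < 2 * (L * (e + 1)) - 1 := fun t => Finset.mem_Ico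
  refine X.whp_of_cover (fun y h => (∀ t ∈ I, t < h.length) ∧
    (∀ t ∈ I, ∀ ρ, h[t]? = some ρ → ¬ X.Hit {x} y ρ) ∧
      2 * Real.log n ≤ ∑ t ∈ I, X.hitRate {x} y (h.take t)) Finset.univ ?_ ?_
  · intro h₀ hh₀ hr₀
    have h1 : Real.exp (-(2 * Real.log n)) = (n : ℝ)⁻¹ * (n : ℝ)⁻¹ := by
      rw [two_mul, neg_add, Real.exp_add, Real.exp_neg, Real.exp_log hn0]
    refine (Finset.sum_le_card_nsmul _ _ _ fun y _ => X.miss_le_exp _ _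
      (fun h hr => hitRate_le_prob hwf {x} y h hr) I hh₀
      (fun t ht => by have := ((hI t).1 ht).1; omega) k _).trans_eq ?_
    rw [h1, Finset.card_univ, ← hn, nsmul_eq_mul, ← ENNReal.ofReal_natCast,
      ← ENNReal.ofReal_mul hn0.le, ← mul_assoc, mul_inv_cancel₀ hn0.ne', one_mul,
      ENNReal.ofReal_inv_of_pos hn0, one_div]
  · intro h hr hlen hE
    push Not at hE
    obtain ⟨m, r', hrr', hbc, hac, y, hxy, hno⟩ := hE
    have hr' := le_ackAt hwf hr hbc hac
    rw [← hLdef, ← he] at hr'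
    have hlt := hac.lt
    refine ⟨y, Finset.mem_univ _, fun t ht => by have := (hI t).1 ht; omega,
      fun t ht ρ hρ hh => ?_, ?_⟩
    · have htI := (hI t).1 ht
      -- In the rounds of `I` node `x` works on `m` only, so a hit from the target set `{x}`
      -- delivers `m`.
      obtain ⟨z, rfl, m', -, h1, s, h2, h3⟩ := exists_rcvAt_of_hit hwf hr hρ hh
      have h4 : X.ActiveWith h t z m := by
        refine ⟨⟨r, htI.1, hbc⟩, fun s hs hack => ?_⟩
        have := le_ackAt hwf hr hbc hack
        rw [← hLdef, ← he] at this
        omega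
      obtain rfl := activeWith_unique hwf hr (by omega) h1 h4
      exact hno s (bcastAt_le_rcvAt hwf hr hbc h3) (by omega) h3
    · have hact : X.Active h (2 * (L * e) - 1) x := by
        refine ⟨m, ⟨r, by omega, hbc⟩, fun s hs hack => ?_⟩
        have := le_ackAt hwf hr hbc hack
        rw [← hLdef, ← he] at this
        omega
      have h1 := le_sum_hitRate_sap (by omega) hb hD hwf hr (Set.mem_singleton x) hxy.symm
        hLdef (e := e) he1 (by omega) hact (hcont h hr y _ (by omega)) I
        fun t h1 h2 => (hI t).2 (by omega)
      have h2 := log_le_lg (by omega) hN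
      have h3 : (8 : ℝ) ≤ a := by exact_mod_cast ha
      have h4 : (0 : ℝ) ≤ lg N := Nat.cast_nonneg _
      nlinarith

theorem solvesLocalBroadcast_of_sapSpp (ha : 8 ≤ a) (hb : 8 * a < b) (hD : 1 ≤ D)
    (hN : Fintype.card V ≤ N) (hwf : X.WellFormed)
    (hcont : ∀ h, X.Reachable h → ∀ x t, t < h.length → X.contention h x t ≤ D) :
    X.SolvesLocalBroadcast where
  ack_of_bcast _ he _ _ _ h := ack_of_bcast_of_isExecution (by omega) hwf he h
  bcast_of_ack _ he _ _ _ h := bcast_of_ack_of_isExecution hwf he h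
  rcv_unique _ he _ _ _ _ h h' := rcv_unique_of_isExecution hwf he h h'
  rcv_valid _ he _ _ _ h := rcv_valid_of_isExecution hwf he h
  reliable := reliable_of_sapSpp ha hb hD hN hwf hcont

/-- No randomness is involved: the clock alone forces the acknowledgment within two SAP epochs. -/
theorem hasAckBound_of_le (ha : 1 ≤ a) (hwf : X.WellFormed) (f : ℕ → ℝ)
    (hf : 2 ≤ Fintype.card V → ∀ k, (4 * (sapEpoch a N D).length : ℝ) ≤ f k) :
    X.HasAckBound f := by
  intro x r k
  rcases Nat.lt_or_ge (Fintype.card V) 2 with hn2 | hn2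
  · exact whp_of_card_le_one (by omega) _ _ _
  refine whp_of_forall fun h hr _ m r' _ hbc hac => ?_
  have h1 : (r' : ℝ) ≤ r + 4 * (sapEpoch a N D).length := by
    exact_mod_cast ackAt_le ha hwf hr hbc hac
  linarith [hf hn2 (X.nbrContentionOn h x r r')]

/-- A progress bound holds if, in intervals that are longer than it, the probabilities of a hit
sum up to at least `log n`. -/
theorem hasProgressBound_of_le_sum (hwf : X.WellFormed) (f : ℕ → ℝ)
    (hf : 2 ≤ Fintype.card V → ∀ (h : X.History) (x y : V) (r d : ℕ), X.Reachable h →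
      h.length = r + d + 1 → f (X.contentionOn h x r (r + d)) < d → X.G.Adj x y →
      (∀ t, r ≤ t → t ≤ r + d → X.Active h t y) →
      Real.log (Fintype.card V) ≤
        ∑ t ∈ Finset.Icc r (r + d), X.hitRate Set.univ x (h.take t)) :
    X.HasProgressBound f := by
  intro x r d
  rcases Nat.lt_or_ge (Fintype.card V) 2 with hn2 | hn2
  · exact whp_of_card_le_one (by omega) _ _ _
  set n := Fintype.card V with hn
  have hn0 : (0 : ℝ) < n := by positivity
  let I := Finset.Icc r (r + d)
  have hI : ∀ t, t ∈ I ↔ r ≤ t ∧ t ≤ r + d := fun t => Finset.mem_Icc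
  refine X.whp_of_cover (fun y h => (∀ t ∈ I, t < h.length) ∧
    (∀ t ∈ I, ∀ ρ, h[t]? = some ρ → ¬ X.Hit Set.univ y ρ) ∧
      Real.log n ≤ ∑ t ∈ I, X.hitRate Set.univ y (h.take t)) {x} ?_ ?_
  · intro h₀ hh₀ hr₀
    -- Only `x` has to make progress, so there is no union bound and `log n` is enough.
    rw [Finset.sum_singleton]
    refine (X.miss_le_exp _ _ (fun h hr => hitRate_le_prob hwf Set.univ x h hr) I hh₀
      (fun t ht => by have := ((hI t).1 ht).1; omega) (d + 1) _).trans_eq ?_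
    rw [Real.exp_neg, Real.exp_log hn0, ENNReal.ofReal_inv_of_pos hn0, one_div,
      ENNReal.ofReal_natCast]
  · intro h hr hlen hE
    push Not at hE
    obtain ⟨hd, ⟨y, hxy, hact⟩, hno⟩ := hE
    refine ⟨x, Finset.mem_singleton_self x, fun t ht => by have := (hI t).1 ht; omega,
      fun t ht ρ hρ hh => ?_, hf hn2 h x y r d hr (by omega) hd hxy hact⟩
    have htI := (hI t).1 ht
    obtain ⟨z, -, m, -, h1, s, h2, h3⟩ := exists_rcvAt_of_hit hwf hr hρ hh
    exact hno m ⟨s, by omega, h3⟩ t z htI.1 htI.2 h1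

/-- An interval of this length contains a whole SAP epoch. -/
theorem log_le_sum_hitRate_of_long (ha : 8 ≤ a) (hb : 8 * a < b) (hD : 1 ≤ D) {n : ℕ}
    (hn : 1 ≤ n) (hN : n ≤ N) (hwf : X.WellFormed)
    (hcont : ∀ h, X.Reachable h → ∀ x t, t < h.length → X.contention h x t ≤ D)
    {h : X.History} {x y : V} {r d : ℕ} (hr : X.Reachable h) (hlen : h.length = r + d + 1)
    (hxy : X.G.Adj x y) (hact : ∀ t, r ≤ t → t ≤ r + d → X.Active h t y)
    (hd : 4 * (sapEpoch a N D).length ≤ d) :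
    Real.log n ≤ ∑ t ∈ Finset.Icc r (r + d), X.hitRate Set.univ x (h.take t) := by
  have hL := length_sapEpoch_pos (by omega : 1 ≤ a) N D
  set L := (sapEpoch a N D).length with hLdef
  set e := r / 2 / L + 1 with he
  have he1 : 1 ≤ e := Nat.le_add_left 1 _
  have hre : r / 2 < L * e := Nat.lt_mul_div_succ _ hL
  have hre' := Nat.mul_div_le (r / 2) L
  have hLe : L * e = L * (r / 2 / L) + L := by rw [he]; ring
  have hLe1 : L * (e + 1) = L * e + L := by ring
  have h1 := le_sum_hitRate_sap (by omega) hb hD hwf hr (Set.mem_univ y) hxy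
    hLdef (e := e) he1 (by omega) (hact _ (by omega) (by omega)) (hcont h hr x _ (by omega))
    (Finset.Icc r (r + d)) fun t h1 h2 => Finset.mem_Icc.2 (by omega)
  have h2 := log_le_lg hn hN
  have h3 : (8 : ℝ) ≤ a := by exact_mod_cast ha
  have h4 : (0 : ℝ) ≤ lg N := Nat.cast_nonneg _
  nlinarith

/-- Both models at once: each SPP epoch contributes `1 / (8 * k)`, where `k` bounds the contention
in the dual graph model and is `1` in the classical model. -/
theorem log_le_sum_hitRate (ha : 8 ≤ a) (hb : 8 * a < b) {n Δ κ : ℕ}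
    (hn : 2 ≤ n) (hN : n ≤ N) (hΔ : 2 ≤ Δ) (hD : 1 ≤ D) (hDκ : D ≤ κ * Δ) (hwf : X.WellFormed)
    (hcont : ∀ h, X.Reachable h → ∀ x t, t < h.length → X.contention h x t ≤ D)
    {h : X.History} {x y : V} {r d : ℕ} (hr : X.Reachable h) (hlen : h.length = r + d + 1)
    (hxy : X.G.Adj x y) (hact : ∀ t, r ≤ t → t ≤ r + d → X.Active h t y) {k : ℕ} (hk : 1 ≤ k)
    (hgle : (X.G = X.G' ∧ k = 1) ∨ ∀ t, r ≤ t → t ≤ r + d → X.contention h x t ≤ k)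
    (hd : 96 * (4 + 4 * κ) * (k * Real.log Δ * Real.log n) ≤ d) :
    Real.log n ≤ ∑ t ∈ Finset.Icc r (r + d), X.hitRate Set.univ x (h.take t) := by
  rcases le_or_gt (4 * (sapEpoch a N D).length) d with hlong | hshort
  · exact log_le_sum_hitRate_of_long ha hb hD (by omega) hN hwf hcont hr hlen hxy hact hlong
  obtain ⟨t₁, t₂, h1, h2, h3, h4, h5⟩ := exists_quiet_interval r
    (min_le_right d (2 * (sapEpoch a N D).length))
  have h6 : min d (2 * (sapEpoch a N D).length) ≤ d := min_le_left _ _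
  -- Since `d` is less than four SAP epoch lengths, the truncation to two loses at most a factor
  -- `2`, and the quiet part another factor `2`.
  have h7 : d + 4 * t₁ ≤ 4 * (t₂ + 1) := by
    rcases min_choice d (2 * (sapEpoch a N D).length) with h | h <;> omega
  have hk0 : (1 : ℝ) ≤ k := by exact_mod_cast hk
  have hsum := le_sum_hitRate_spp (by omega) hb hD hwf hr hxy (t₁ := t₁) (t₂ := t₂) (by omega)
    (fun t ht1 ht2 => hact t (by omega) (by omega))
    (fun t ht1 ht2 => hcont h hr x t (by omega)) h5 (g := 1 / (8 * k)) (by positivity) ?_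
    (Finset.Icc r (r + d)) fun t ht1 ht2 => Finset.mem_Icc.2 (by omega)
  · refine le_trans ?_ hsum
    have h8 : (d : ℝ) + 4 * t₁ ≤ 4 * (t₂ + 1) := by exact_mod_cast h7
    have h9 := lg_le_of_le_mul hΔ hD hDκ
    have h10 : (1 : ℝ) ≤ lg D := by exact_mod_cast one_le_lg D
    have h11 := half_le_log hn
    -- The constant is `96 = 4 * 2 * 12`: `4` for the quiet part, `2` for the interleaving, and `12
    -- * (k * log n)` epochs, of which at least `8 * (k * log n)` remain after subtracting `2`,
    -- because `k * log n ≥ 1 / 2`.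
    have h12 : 96 * (lg D * (k * Real.log n)) ≤ 4 * ((t₂ : ℝ) + 1 - t₁) := by
      have h13 : (lg D : ℝ) * (k * Real.log n) ≤
          (4 + 4 * κ) * Real.log Δ * (k * Real.log n) := by gcongr
      linarith
    have h13 : 12 * (k * Real.log n) ≤ ((t₂ : ℝ) + 1 - t₁) / (2 * lg D) := by
      rw [le_div_iff₀ (by positivity)]
      linarith
    rw [mul_one_div, le_div_iff₀ (by positivity)]
    nlinarith
  · rcases hgle with ⟨hG, rfl⟩ | hle
    · exact Or.inl ⟨hG, by norm_num⟩
    · refine Or.inr fun t ht1 ht2 => ?_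
      have h8 : (1 : ℝ) ≤ X.contention h x t := by
        exact_mod_cast one_le_contention (X.le hxy) (hact t (by omega) (by omega))
      have h9 : (X.contention h x t : ℝ) ≤ k := by exact_mod_cast hle t (by omega) (by omega)
      gcongr

end Setting

/-- The bounds for SAP interleaved with SPP, with an explicit constant. -/
theorem bounds_of_sapSpp {V : Type v} [Fintype V] {M : Type u} {a b κ p N D Δ : ℕ} (ha : 8 ≤ a)
    (hb : 8 * a < b) (hN : Fintype.card V ≤ N) (hNp : N ≤ Fintype.card V ^ p) (hΔ : 2 ≤ Δ)
    (hΔD : Δ ≤ D) (hDκ : D ≤ κ * Δ) (X : SapSppSetting a b N D V M) (hwf : X.WellFormed)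
    (hmax : X.maxContention ≤ (Δ : ℕ∞)) {C : ℝ}
    (hC : C = 32 * a * κ * (1 + p) + 96 * (4 + 4 * κ)) :
    X.SolvesLocalBroadcast ∧
      X.HasAckBound (fun _ => C * (Δ * Real.log (Fintype.card V))) ∧
      X.HasProgressBound (fun k =>
        C * min (k * Real.log Δ * Real.log (Fintype.card V))
          (Δ * Real.log (Fintype.card V))) ∧
      (X.G = X.G' → X.HasProgressBound (fun _ =>
        C * (Real.log Δ * Real.log (Fintype.card V)))) := by
  have hcont : ∀ h, X.Reachable h → ∀ x t, t < h.length → X.contention h x t ≤ D :=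
    fun h hr x t ht => (Setting.contention_le hmax hr x ht).trans hΔD
  have hlogΔ := half_le_log hΔ
  have hC1 : 32 * a * κ * (1 + p) ≤ C := by
    rw [hC]
    exact le_add_of_nonneg_right (by positivity)
  have hC2 : 96 * (4 + 4 * (κ : ℝ)) ≤ C := by
    rw [hC]
    exact le_add_of_nonneg_left (by positivity)
  have hlen : 2 ≤ Fintype.card V →
      (4 * (sapEpoch a N D).length : ℝ) ≤ C * (Δ * Real.log (Fintype.card V)) := by
    intro hn
    have hlog := half_le_log hn
    have h1 : ((sapEpoch a N D).length : ℝ) ≤ 4 * (a * D * lg N) := by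
      exact_mod_cast length_sapEpoch_le a N (by omega : 1 ≤ D)
    have h2 := lg_le_of_le_pow hn (by omega) hNp
    have h3 : (D : ℝ) ≤ κ * Δ := by exact_mod_cast hDκ
    calc (4 * (sapEpoch a N D).length : ℝ) ≤ 4 * (4 * (a * D * lg N)) := by gcongr
      _ ≤ 4 * (4 * (a * (κ * Δ) * (2 * (1 + p) * Real.log (Fintype.card V)))) := by gcongr
      _ = 32 * a * κ * (1 + p) * (Δ * Real.log (Fintype.card V)) := by ring
      _ ≤ _ := by gcongr
  refine ⟨Setting.solvesLocalBroadcast_of_sapSpp ha hb (by omega) hN hwf hcont,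
    Setting.hasAckBound_of_le (by omega) hwf _ fun hn _ => hlen hn,
    Setting.hasProgressBound_of_le_sum hwf _ ?_,
    fun hG => Setting.hasProgressBound_of_le_sum hwf _ ?_⟩
  · intro hn h x y r d hr hlen' hd hxy hact
    have hlog := half_le_log hn
    have hsup : ∀ t, r ≤ t → t ≤ r + d → X.contention h x t ≤ X.contentionOn h x r (r + d) :=
      fun t h1 h2 => Finset.le_sup (f := X.contention h x) (Finset.mem_Icc.2 ⟨h1, h2⟩)
    -- SPP accounts for the first term of the minimum, SAP for the second.
    rcases min_choice (X.contentionOn h x r (r + d) * Real.log Δ * Real.log (Fintype.card V))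
      (Δ * Real.log (Fintype.card V)) with hm | hm
    · rw [hm] at hd
      refine Setting.log_le_sum_hitRate ha hb hn hN hΔ (by omega) hDκ hwf hcont hr hlen' hxy hact
        ((Setting.one_le_contention (X.le hxy) (hact r le_rfl (by omega))).trans
          (hsup r le_rfl (by omega))) (Or.inr hsup) (le_trans ?_ hd.le)
      gcongr
    · rw [hm] at hd
      refine Setting.log_le_sum_hitRate_of_long ha hb (by omega) (by omega) hN hwf hcont hr hlen'
        hxy hact ?_
      exact_mod_cast (hlen hn).trans hd.le
  · intro hn h x y r d hr hlen' hd hxy hact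
    have hlog := half_le_log hn
    refine Setting.log_le_sum_hitRate ha hb hn hN hΔ (by omega) hDκ hwf hcont hr hlen' hxy hact
      le_rfl (Or.inl ⟨hG, rfl⟩) (le_trans ?_ hd.le)
    rw [Nat.cast_one, one_mul]
    gcongr

end RadioNetwork

end

theorem mainTheorem3 :
    ∃ a₀ : ℕ, ∀ a ≥ a₀, ∃ b₀ : ℕ, ∀ b ≥ b₀, ∀ κ p : ℕ, ∃ C : ℝ, 0 < C ∧
      ∀ (V : Type v) [Fintype V] (M : Type u) (N D Δ : ℕ),
        Fintype.card V ≤ N → N ≤ Fintype.card V ^ p →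
        2 ≤ Δ → Δ ≤ D → D ≤ κ * Δ →
        ∀ X : RadioNetwork.Setting (RadioNetwork.sapSpp a b N D V M),
          X.WellFormed → X.maxContention ≤ (Δ : ℕ∞) →
          -- dual graph model
          (X.SolvesLocalBroadcast ∧
            X.HasAckBound (fun _ => C * (Δ * Real.log (Fintype.card V))) ∧
            X.HasProgressBound (fun k =>
              C * min (k * Real.log Δ * Real.log (Fintype.card V))
                (Δ * Real.log (Fintype.card V)))) ∧
          -- classical model
          (X.G = X.G' →
            X.SolvesLocalBroadcast ∧
            X.HasAckBound (fun _ => C * (Δ * Real.log (Fintype.card V))) ∧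
            X.HasProgressBound (fun _ =>
              C * (Real.log Δ * Real.log (Fintype.card V)))) := by
  -- The first summand of `C` comes from the length of two SAP epochs, the second from the SPP
  -- progress bound.
  refine ⟨8, fun a ha => ⟨8 * a + 1, fun b hb κ p =>
    ⟨32 * a * κ * (1 + p) + 96 * (4 + 4 * κ), by positivity, ?_⟩⟩⟩
  intro V _ M N D Δ hN hNp hΔ hΔD hDκ X hwf hmax
  obtain ⟨h1, h2, h3, h4⟩ := RadioNetwork.bounds_of_sapSpp ha hb hN hNp hΔ hΔD hDκ X hwf hmax rfl
  exact ⟨⟨h1, h2, h3⟩, fun hG => ⟨h1, h2, h4 hG⟩⟩
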